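/- Let $1\le m\le n$. Let $\mathfrak M_{n,m}$ be the space of real $n\times m$ matrices with Lebesgue measure $dx=\prod dx_{i,j}$; write $x'$ for the transpose and $|x|_m=\det(x'x)^{1/2}$. Let $\mathcal P_m$ be the cone of positive definite symmetric $m\times m$ matrices, with $dr=\prod_{i\le j}dr_{i,j}$ and invariant measure $d_*r=\det(r)^{-(m+1)/2}\,dr$. Write $s>t$ if $s-t\in\mathcal P_m$, and $\int_a^b$ for integration over $\{s: a<s<b\}$. A function $u_0:\mathcal P_m\to\mathbb C$ is called symmetric if $u_0(s^{1/2}rs^{1/2})=u_0(r^{1/2}sr^{1/2})$ for all $r,s\in\mathcal P_m$. Put $\sigma_{n,m}=2^m\pi^{nm/2}/\Gamma_m(n/2)$, where $\Gamma_m(\alpha)=\int_{\mathcal P_m}e^{-\mathrm{tr}\,r}\det(r)^{\alpha-(m+1)/2}\,dr$. Let $\nu$ be a finite complex Borel measure on $\mathfrak M_{n,m}$ that is radial, i.e. $\int\psi(\gamma x)\,d\nu(x)=\int\psi(x)\,d\nu(x)$ for all $\gamma\in SO(n)$ and all continuous compactly supported $\psi$. Let $(\mathcal F\nu)(y)=\int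 e^{i\,\mathrm{tr}(y'x)}\,d\nu(x)$, and suppose that there is a symmetric function $u_0$ on $\mathcal P_m$ with $(\mathcal F\nu)(y)=u_0(y'y)$ for all $y\in\mathfrak M_{n,m}$ of rank $m$. For $A,B\in\mathcal P_m$ put $$K(A,B)=\frac{2^m}{\sigma_{n,m}}\int_{\{z\in\mathfrak M_{n,m}:\,A<z'z<B\}}\frac{(\mathcal F\nu)(z)}{|z|_m^n}\,dz .$$ Suppose that the limit $c_\nu=\lim K(A,B)\in\mathbb C$ exists as $A\to0$ and $B\to\infty$ in $\mathcal P_m$ (where $B\to\infty$ means that the smallest eigenvalue of $B$ tends to $\infty$), and that the truncated integrals $K(A,B)$, $A,B\in\mathcal P_m$, are uniformly bounded. (Both hold, for example, if $\int|(\mathcal F\nu)(z)|\,|z|_m^{-n}\,dz<\infty$.) For $a\in\mathcal P_m$ let $(W_{\nu,a}f)(x)=\int f(x-ya^{1/2})\,d\nu(y)$. Then for every $f\in L^2(\mathfrak M_{n,m})$: (1) for every $a\in\mathcal P_m$, the integral defining $(W_{\nu,a}f)(x)$ converges absolutely for almost every $x$; (2) for all $0<\varepsilon<\rho<\infty$,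 the integral $I_{\varepsilon,\rho}(x)=\int_{\varepsilon I_m}^{\rho I_m}(W_{\nu,a}f)(x)\,d_*a$ converges absolutely for almost every $x$, and $I_{\varepsilon,\rho}\in L^2(\mathfrak M_{n,m})$; (3) $\|I_{\varepsilon,\rho}-c_\nu f\|_{L^2}\to0$ as $\varepsilon\to0$ and $\rho\to\infty$ jointly. -/

import Mathlib

open MeasureTheory Filter Topology
open scoped Matrix CompactlySupported

namespace MatrixWavelet

noncomputable section

/-- The product σ-algebra on the space of real `n × m` matrices. -/
instance matMeasurableSpace (n m : ℕ) : MeasurableSpace (Matrix (Fin n) (Fin m) ℝ) :=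
  inferInstanceAs (MeasurableSpace (Fin n → Fin m → ℝ))

/-- It is the Borel σ-algebra. -/
instance matBorelSpace (n m : ℕ) : BorelSpace (Matrix (Fin n) (Fin m) ℝ) :=
  inferInstanceAs (BorelSpace (Fin n → Fin m → ℝ))

/-- Lebesgue measure `dx = ∏ dx_{i,j}` on the space of real `n × m` matrices. -/
instance matMeasureSpace (n m : ℕ) : MeasureSpace (Matrix (Fin n) (Fin m) ℝ) :=
  inferInstanceAs (MeasureSpace (Fin n → Fin m → ℝ))

/-- The cone of positive definite symmetric `m × m` matrices. -/
def cone (m : ℕ) : Set (Matrix (Fin m) (Fin m) ℝ) := {r | r.PosDef}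

/-- The interval `{s : a < s < b}` for the order in which `a < s` means that `s - a` is
positive definite. -/
def coneInterval {m : ℕ} (a b : Matrix (Fin m) (Fin m) ℝ) : Set (Matrix (Fin m) (Fin m) ℝ) :=
  {s | (s - a).PosDef ∧ (b - s).PosDef}

/-- The symmetric matrix with prescribed entries `r_{i,j}`, `i ≤ j`. -/
def symOfUpper {m : ℕ} (t : {p : Fin m × Fin m // p.1 ≤ p.2} → ℝ) : Matrix (Fin m) (Fin m) ℝ :=
  Matrix.of fun i j => t ⟨(min i j, max i j), min_le_max⟩

/-- The measure `dr = ∏_{i ≤ j} dr_{i,j}` on symmetric matrices (as a measure on all square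
matrices carried by the symmetric ones). -/
def lebSym (m : ℕ) : Measure (Matrix (Fin m) (Fin m) ℝ) :=
  Measure.map symOfUpper (volume : Measure ({p : Fin m × Fin m // p.1 ≤ p.2} → ℝ))

/-- The invariant measure `d_* r = |r|^{-d} dr`, `d = (m + 1) / 2`, on the cone. -/
def dStar (m : ℕ) : Measure (Matrix (Fin m) (Fin m) ℝ) :=
  ((lebSym m).restrict (cone m)).withDensity
    fun r => ENNReal.ofReal (r.det ^ (-(((m : ℝ) + 1) / 2)))

/-- The square root `r^{1/2}` of a positive semidefinite matrix. -/
def msqrt {m : ℕ} (r : Matrix (Fin m) (Fin m) ℝ) : Matrix (Fin m) (Fin m) ℝ :=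
  cfc Real.sqrt r

/-- Symmetric functions on the cone:
`w₀ (s^{1/2} r s^{1/2}) = w₀ (r^{1/2} s r^{1/2})` for all `r`, `s` in the cone. -/
def IsSymmetricOnCone {m : ℕ} (w₀ : Matrix (Fin m) (Fin m) ℝ → ℂ) : Prop :=
  ∀ r s : Matrix (Fin m) (Fin m) ℝ, r.PosDef → s.PosDef →
    w₀ (msqrt s * r * msqrt s) = w₀ (msqrt r * s * msqrt r)

/-- The Siegel gamma function (at a real argument)
`Γ_m(α) = ∫_{P_m} exp(-tr r) |r|^{α-d} dr`, `d = (m + 1) / 2`. -/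
def siegelGamma (m : ℕ) (α : ℝ) : ℝ :=
  ∫ r in cone m, Real.exp (-r.trace) * r.det ^ (α - ((m : ℝ) + 1) / 2) ∂(lebSym m)

/-- The constant `σ_{n,m} = 2^m π^{nm/2} / Γ_m(n/2)`, the total mass of the Stiefel manifold. -/
def stiefelMass (n m : ℕ) : ℝ :=
  2 ^ m * Real.pi ^ ((n : ℝ) * m / 2) / siegelGamma m ((n : ℝ) / 2)

/-- `|x|_m = det(x'x)^{1/2}`. -/
def matVol {n m : ℕ} (x : Matrix (Fin n) (Fin m) ℝ) : ℝ := Real.sqrt (xᵀ * x).det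

/-- The integral `∫ g dν` of a complex function against a complex measure. -/
def cintegral {n m : ℕ} (ν : ComplexMeasure (Matrix (Fin n) (Fin m) ℝ))
    (g : Matrix (Fin n) (Fin m) ℝ → ℂ) : ℂ :=
  ∫ᵛ x, g x ∂[ContinuousLinearMap.mul ℝ ℂ; ν]

/-- Radial measures: `∫ ψ(γx) dν(x) = ∫ ψ(x) dν(x)` for all `γ ∈ SO(n)` and all continuous
compactly supported `ψ`. -/
def IsRadial {n m : ℕ} (ν : ComplexMeasure (Matrix (Fin n) (Fin m) ℝ)) : Prop :=
  ∀ γ ∈ Matrix.specialOrthogonalGroup (Fin n) ℝ, ∀ ψ : C_c(Matrix (Fin n) (Fin m) ℝ, ℂ),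
    cintegral ν (fun x => ψ (γ * x)) = cintegral ν (fun x => ψ x)

/-- The Fourier transform `(Fν)(y) = ∫ exp(tr(i y'x)) dν(x)`. -/
def fourierMeasure {n m : ℕ} (ν : ComplexMeasure (Matrix (Fin n) (Fin m) ℝ))
    (y : Matrix (Fin n) (Fin m) ℝ) : ℂ :=
  cintegral ν fun x => Complex.exp (Complex.I * ((yᵀ * x).trace : ℂ))

/-- The wavelet transform `(W_{ν,a} f)(x) = ∫ f(x - y a^{1/2}) dν(y)`. -/
def waveletTransform {n m : ℕ} (ν : ComplexMeasure (Matrix (Fin n) (Fin m) ℝ))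
    (a : Matrix (Fin m) (Fin m) ℝ) (f : Matrix (Fin n) (Fin m) ℝ → ℂ)
    (x : Matrix (Fin n) (Fin m) ℝ) : ℂ :=
  cintegral ν fun y => f (x - y * msqrt a)

/-- The truncated integral
`∫_{εI}^{ρI} (W_{ν,a} f)(x) d_* a`. -/
def truncatedCalderon {n m : ℕ} (ν : ComplexMeasure (Matrix (Fin n) (Fin m) ℝ)) (ε ρ : ℝ)
    (f : Matrix (Fin n) (Fin m) ℝ → ℂ) (x : Matrix (Fin n) (Fin m) ℝ) : ℂ :=
  ∫ a in coneInterval (ε • (1 : Matrix (Fin m) (Fin m) ℝ)) (ρ • 1),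
    waveletTransform ν a f x ∂(dStar m)

/-- The truncated integral
`(2^m / σ_{n,m}) ∫_{A < z'z < B} (Fν)(z) / |z|_m^n dz` defining the constant `c_ν`. -/
def truncatedConstant {n m : ℕ} (ν : ComplexMeasure (Matrix (Fin n) (Fin m) ℝ))
    (A B : Matrix (Fin m) (Fin m) ℝ) : ℂ :=
  ((2 ^ m / stiefelMass n m : ℝ) : ℂ) *
    ∫ z in {z : Matrix (Fin n) (Fin m) ℝ | zᵀ * z ∈ coneInterval A B},
      fourierMeasure ν z / ((matVol z ^ n : ℝ) : ℂ)

/-- `A → 0` within the cone. -/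
def coneNhdsZero (m : ℕ) : Filter (Matrix (Fin m) (Fin m) ℝ) := 𝓝[cone m] 0

/-- `B → ∞` within the cone: for every real `R`, eventually `B > R I_m`
(i.e. the smallest eigenvalue of `B` tends to infinity). -/
def coneAtTop (m : ℕ) : Filter (Matrix (Fin m) (Fin m) ℝ) :=
  ⨅ R : ℝ, 𝓟 {B | B.PosDef ∧ (B - R • (1 : Matrix (Fin m) (Fin m) ℝ)).PosDef}

end

end MatrixWavelet

open MatrixWavelet

namespace MatrixWavelet

/-! The truncated integral is an average of translates of `f` over pairs `(a, y)` against `d_*a ×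
ν`, so on the Fourier side it is multiplication by a bounded function. At the frequency `ζ` the
multiplier is `∫ (Fν)(z a^{1/2}) d_*a` over `εI < a < ρI`, with `z = -2πζ`. Put `r = zᵀz`. For `z`
of full rank the integrand is `u₀(a^{1/2} r a^{1/2})`, which the symmetry of `u₀` turns into
`u₀(r^{1/2} a r^{1/2})`. The invariance of `d_*a` under `a ↦ r^{1/2} a r^{1/2}` then gives `∫ u₀
d_*s` over `εr < s < ρr`, and the polar decomposition of Lebesgue measure identifies this with
`K(εr, ρr)` (`integral_fourierMeasure_mul_msqrt`). For almost every `ζ` the matrix `r` is positive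
definite, so the multipliers are uniformly bounded and tend to `c` pointwise. Plancherel and
dominated convergence finish the proof.

Three ingredients carry this. The polar decomposition `gramMeasure_eq_smul_dStar` comes from
uniqueness of congruence-invariant measures on the cone, proved by a Tonelli argument against the
Haar measure `|det g|^{-m} dg` of `GL_m`; a Gaussian test function fixes the constant. A complex
measure is written as `k |ν|` with `|k| = 1` (`exists_unimodular_density`), which reduces integrals
against `ν` to Bochner integrals. The multiplier description (`fourier_average_ae_eq`) is obtained
by testing against Schwartz functions. -/

instance matVolumeIsAddHaar (n m : ℕ) :
    (volume : Measure (Matrix (Fin n) (Fin m) ℝ)).IsAddHaarMeasure :=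
  Measure.pi.isAddHaarMeasure (fun _ : Fin n => (volume : Measure (Fin m → ℝ)))

instance matVolumeSigmaFinite (n m : ℕ) :
    SigmaFinite (volume : Measure (Matrix (Fin n) (Fin m) ℝ)) :=
  inferInstanceAs (SigmaFinite (volume : Measure (Fin n → Fin m → ℝ)))

instance matSecondCountable (n m : ℕ) : SecondCountableTopology (Matrix (Fin n) (Fin m) ℝ) :=
  inferInstanceAs (SecondCountableTopology (Fin n → Fin m → ℝ))

/-! ### The matrix square root, the cone, and coordinates of symmetric matrices. -/

variable {m : ℕ}

-- The continuous functional calculus varies continuously as long as nearby spectra stay in one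
-- compact set; near `x₀` the ball of radius `‖x₀‖ + 1` serves.
open scoped Matrix.Norms.L2Operator in
theorem continuousOn_msqrt : ContinuousOn (msqrt (m := m)) {r | r.IsHermitian} := by
  rw [continuousOn_iff_continuous_domRestrict]
  refine Continuous.cfc (A := Matrix (Fin m) (Fin m) ℝ) (s := fun x => Metric.closedBall 0 (‖x.1‖ + 1))
    (p := IsSelfAdjoint) Real.sqrt
    continuous_subtype_val (fun x => isCompact_closedBall _ _) ?_
    (fun _ => Real.continuous_sqrt.continuousOn) (fun x => x.2)
  intro x₀
  have : ∀ᶠ x : {r : Matrix (Fin m) (Fin m) ℝ | r.IsHermitian} in 𝓝 x₀, ‖x.1‖ < ‖x₀.1‖ + 1 :=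
    (continuous_subtype_val.norm.tendsto x₀).eventually (gt_mem_nhds (lt_add_one _))
  filter_upwards [this] with x hx
  refine (spectrum.subset_closedBall_norm_mul _).trans (Metric.closedBall_subset_closedBall ?_)
  -- The spectral bound is `‖x‖ * ‖1‖`, and `‖1‖` is `0` rather than `1` when `m = 0`.
  rcases isEmpty_or_nonempty (Fin m) with h | h
  · have : ‖(1 : Matrix (Fin m) (Fin m) ℝ)‖ = 0 := by
      rw [Subsingleton.elim (1 : Matrix (Fin m) (Fin m) ℝ) 0, norm_zero]
    rw [this]; simp; positivity
  · rw [CStarRing.norm_one, mul_one]; exact hx.le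

theorem isClosed_isHermitian : IsClosed {r : Matrix (Fin m) (Fin m) ℝ | r.IsHermitian} :=
  isClosed_eq (by fun_prop) continuous_id

theorem measurable_msqrt : Measurable (msqrt (m := m)) := by
  classical
  -- Off the closed set of Hermitian matrices `cfc` takes its default value `0`.
  have : msqrt (m := m) = {r : Matrix (Fin m) (Fin m) ℝ | r.IsHermitian}.piecewise msqrt 0 := by
    ext1 r
    by_cases hr : r.IsHermitian
    · exact (Set.piecewise_eq_of_mem _ _ _ (show r ∈ {r | r.IsHermitian} from hr)).symm
    · rw [Set.piecewise_eq_of_notMem _ _ _ (show r ∉ {r | r.IsHermitian} from hr)]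
      exact cfc_apply_of_not_predicate r hr
  rw [this]
  exact continuousOn_msqrt.measurable_piecewise continuousOn_const
    isClosed_isHermitian.measurableSet

theorem msqrt_isHermitian (r : Matrix (Fin m) (Fin m) ℝ) : (msqrt r).IsHermitian :=
  cfc_predicate Real.sqrt r

theorem transpose_msqrt (r : Matrix (Fin m) (Fin m) ℝ) : (msqrt r)ᵀ = msqrt r :=
  msqrt_isHermitian r

open scoped MatrixOrder in
theorem msqrt_mul_self {r : Matrix (Fin m) (Fin m) ℝ} (hr : r.PosSemidef) :
    msqrt r * msqrt r = r := by
  have hsa : IsSelfAdjoint r := hr.isHermitian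
  rw [msqrt, ← cfc_mul Real.sqrt Real.sqrt r Real.continuous_sqrt.continuousOn
    Real.continuous_sqrt.continuousOn]
  conv_rhs => rw [← cfc_id ℝ r]
  refine cfc_congr fun x hx => Real.mul_self_sqrt ?_
  exact spectrum_nonneg_of_nonneg (Matrix.nonneg_iff_posSemidef.2 hr) hx

open scoped MatrixOrder in
theorem msqrt_posDef {r : Matrix (Fin m) (Fin m) ℝ} (hr : r.PosDef) : (msqrt r).PosDef := by
  have h : (msqrt r).PosSemidef :=
    Matrix.nonneg_iff_posSemidef.1 (cfc_nonneg fun x _ => Real.sqrt_nonneg x)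
  rw [h.posDef_iff_det_ne_zero]
  intro h0
  have := congrArg Matrix.det (msqrt_mul_self hr.posSemidef)
  rw [Matrix.det_mul, h0, zero_mul] at this
  exact hr.det_pos.ne this

theorem isUnit_det_msqrt {r : Matrix (Fin m) (Fin m) ℝ} (hr : r.PosDef) : IsUnit (msqrt r).det :=
  (msqrt_posDef hr).det_pos.ne'.isUnit

theorem isClosed_posSemidef : IsClosed {r : Matrix (Fin m) (Fin m) ℝ | r.PosSemidef} := by
  have : {r : Matrix (Fin m) (Fin m) ℝ | r.PosSemidef} =
      {r | r.IsHermitian} ∩ ⋂ x : Fin m → ℝ, {r | 0 ≤ x ⬝ᵥ (r *ᵥ x)} := by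
    ext r
    simp [Matrix.posSemidef_iff_dotProduct_mulVec]
  rw [this]
  refine isClosed_isHermitian.inter (isClosed_iInter fun x => isClosed_le continuous_const ?_)
  fun_prop

theorem measurableSet_cone : MeasurableSet (cone m) := by
  have : cone m = {r | r.PosSemidef} ∩ {r | r.det ≠ 0} := by
    ext r
    exact ⟨fun h => ⟨h.posSemidef, h.det_pos.ne'⟩, fun h => h.1.posDef_iff_det_ne_zero.2 h.2⟩
  rw [this]
  refine isClosed_posSemidef.measurableSet.inter (IsOpen.measurableSet ?_)
  exact isOpen_ne_fun (by fun_prop) continuous_const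

theorem measurableSet_coneInterval (a b : Matrix (Fin m) (Fin m) ℝ) :
    MeasurableSet (coneInterval a b) :=
  ((continuous_id.sub continuous_const).measurable measurableSet_cone).inter
    ((continuous_const.sub continuous_id).measurable measurableSet_cone)

theorem coneInterval_subset_cone {a b : Matrix (Fin m) (Fin m) ℝ} (ha : a.PosSemidef) :
    coneInterval a b ⊆ cone m := fun s hs => by
  have := hs.1.add_posSemidef ha
  rwa [sub_add_cancel] at this

/-- Congruence by an invertible matrix preserves positive definiteness. -/
theorem posDef_congr_iff {g : Matrix (Fin m) (Fin m) ℝ} (hg : IsUnit g.det)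
    {s : Matrix (Fin m) (Fin m) ℝ} : (g * s * gᵀ).PosDef ↔ s.PosDef :=
  Matrix.IsUnit.posDef_star_right_conjugate_iff ((Matrix.isUnit_iff_isUnit_det g).2 hg)

theorem coneInterval_congr {g : Matrix (Fin m) (Fin m) ℝ} (hg : IsUnit g.det)
    {a b s : Matrix (Fin m) (Fin m) ℝ} :
    g * s * gᵀ ∈ coneInterval (g * a * gᵀ) (g * b * gᵀ) ↔ s ∈ coneInterval a b := by
  simp only [coneInterval, Set.mem_ofPred_eq, ← Matrix.sub_mul, ← Matrix.mul_sub,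
    posDef_congr_iff hg]

/-- Entries of a positive semidefinite matrix are bounded by its trace. -/
theorem abs_entry_le_trace {s : Matrix (Fin m) (Fin m) ℝ} (hs : s.PosSemidef) (i j : Fin m) :
    |s i j| ≤ s.trace := by
  classical
  have hd : ∀ k, 0 ≤ s k k := fun k => hs.diag_nonneg
  have hsym : s j i = s i j := by
    have := congrFun (congrFun hs.isHermitian i) j
    simpa using this
  by_cases hij : i = j
  · subst hij
    rw [abs_of_nonneg (hd i)]
    exact Finset.single_le_sum (f := fun k => s k k) (fun k _ => hd k) (Finset.mem_univ i)
  have htr : s i i + s j j ≤ s.trace := by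
    rw [← Finset.sum_pair hij (f := fun k => s k k)]
    exact Finset.sum_le_sum_of_subset_of_nonneg (Finset.subset_univ _) (fun k _ _ => hd k)
  -- The quadratic form at `e_i + c e_j`; the choices `c = ±1` give `2|s i j| ≤ s i i + s j j`.
  have key : ∀ c : ℝ, 0 ≤ s i i + 2 * c * s i j + c ^ 2 * s j j := fun c => by
    have h := hs.dotProduct_mulVec_nonneg (Pi.single i 1 + Pi.single j c)
    simp [Matrix.mulVec_add, add_dotProduct, dotProduct_add, hsym] at h
    linarith
  have h1 := key 1
  have h2 := key (-1)
  rw [abs_le]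
  constructor <;> nlinarith [hd i, hd j]

/-- `(Fin m → ℝ)`-coordinates of a symmetric matrix. -/
theorem isHermitian_symOfUpper (t : {p : Fin m × Fin m // p.1 ≤ p.2} → ℝ) :
    (symOfUpper t).IsHermitian := by
  ext i j
  simp [symOfUpper, min_comm, max_comm]

theorem continuous_symOfUpper : Continuous (symOfUpper (m := m)) := by
  unfold symOfUpper
  fun_prop

/-- The coordinates `r_{i,j}`, `i ≤ j`, of a matrix. -/
def upperOfSym (s : Matrix (Fin m) (Fin m) ℝ) : {p : Fin m × Fin m // p.1 ≤ p.2} → ℝ :=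
  fun p => s p.1.1 p.1.2

theorem upperOfSym_symOfUpper (t : {p : Fin m × Fin m // p.1 ≤ p.2} → ℝ) :
    upperOfSym (symOfUpper t) = t := by
  ext ⟨⟨i, j⟩, h⟩
  simp only [upperOfSym, symOfUpper, Matrix.of_apply, min_eq_left h, max_eq_right h]

theorem symOfUpper_upperOfSym {s : Matrix (Fin m) (Fin m) ℝ} (hs : s.IsHermitian) :
    symOfUpper (upperOfSym s) = s := by
  ext i j
  rcases le_total i j with h | h
  · simp only [upperOfSym, symOfUpper, Matrix.of_apply, min_eq_left h, max_eq_right h]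
  · simp only [upperOfSym, symOfUpper, Matrix.of_apply, min_eq_right h, max_eq_left h]
    have := congrFun (congrFun hs i) j
    simpa using this

end MatrixWavelet

/-! ### The Jacobian of a congruence and the invariance of `d_*r`. -/

namespace MatrixWavelet

variable {n m : ℕ}

/-- The congruence `s ↦ g s gᵀ` of symmetric matrices in the coordinates `s_{i,j}`, `i ≤ j`. -/
def congrUpper (g : Matrix (Fin m) (Fin m) ℝ) :
    ({p : Fin m × Fin m // p.1 ≤ p.2} → ℝ) →ₗ[ℝ] ({p : Fin m × Fin m // p.1 ≤ p.2} → ℝ) where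
  toFun t := upperOfSym (g * symOfUpper t * gᵀ)
  map_add' s t := by
    have : symOfUpper (s + t) = symOfUpper s + symOfUpper t := rfl
    rw [this, Matrix.mul_add, Matrix.add_mul]; rfl
  map_smul' c t := by
    have : symOfUpper (c • t) = c • symOfUpper t := rfl
    rw [this, Matrix.mul_smul, Matrix.smul_mul]; rfl

theorem isHermitian_congr (g : Matrix (Fin m) (Fin m) ℝ) {s : Matrix (Fin m) (Fin m) ℝ}
    (hs : s.IsHermitian) : (g * s * gᵀ).IsHermitian :=
  Matrix.isHermitian_mul_mul_conjTranspose g hs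

theorem symOfUpper_congrUpper (g : Matrix (Fin m) (Fin m) ℝ)
    (t : {p : Fin m × Fin m // p.1 ≤ p.2} → ℝ) :
    symOfUpper (congrUpper g t) = g * symOfUpper t * gᵀ :=
  symOfUpper_upperOfSym (isHermitian_congr g (isHermitian_symOfUpper t))

theorem congrUpper_mul (g h : Matrix (Fin m) (Fin m) ℝ) :
    congrUpper (g * h) = congrUpper g * congrUpper h := by
  refine LinearMap.ext fun t => ?_
  change upperOfSym (g * h * symOfUpper t * (g * h)ᵀ) = upperOfSym (g * symOfUpper (congrUpper h t) * gᵀ)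
  rw [symOfUpper_congrUpper, Matrix.transpose_mul]
  simp only [Matrix.mul_assoc]

theorem congrUpper_one : congrUpper (1 : Matrix (Fin m) (Fin m) ℝ) = 1 := by
  refine LinearMap.ext fun t => ?_
  change upperOfSym (1 * symOfUpper t * 1ᵀ) = t
  rw [Matrix.one_mul, Matrix.transpose_one, Matrix.mul_one, upperOfSym_symOfUpper]

/-- The coordinate `(i, j)` is multiplied by `d i * d j`. Over all pairs `i ≤ j` each index occurs
`m + 1` times, the diagonal pair counting twice. -/
theorem det_congrUpper_diagonal (d : Fin m → ℝ) :
    LinearMap.det (congrUpper (Matrix.diagonal d)) = (∏ i, d i) ^ (m + 1) := by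
  have h1 : congrUpper (Matrix.diagonal d) =
      Matrix.toLin' (Matrix.diagonal fun p : {p : Fin m × Fin m // p.1 ≤ p.2} =>
        d p.1.1 * d p.1.2) := by
    refine LinearMap.ext fun t => ?_
    ext ⟨⟨i, j⟩, h⟩
    change (Matrix.diagonal d * symOfUpper t * (Matrix.diagonal d)ᵀ) i j = _
    have := congrFun (upperOfSym_symOfUpper t) ⟨⟨i, j⟩, h⟩
    simp only [upperOfSym] at this
    simp [this, Matrix.mulVec_diagonal]
    ring
  rw [h1, LinearMap.det_toLin', Matrix.det_diagonal, Finset.prod_mul_distrib]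
  have h2 : ∀ F : Fin m × Fin m → ℝ, ∏ p : {p : Fin m × Fin m // p.1 ≤ p.2}, F p.1 =
      ∏ i, ∏ j, if i ≤ j then F (i, j) else 1 := fun F => by
    rw [← Fintype.prod_prod_type' (f := fun i j => if i ≤ j then F (i, j) else 1)]
    rw [Finset.prod_ite, Finset.prod_const_one, mul_one]
    exact (Finset.prod_subtype _ (by simp) F).symm
  rw [h2 (fun p => d p.1), h2 (fun p => d p.2), Finset.prod_comm (f := fun i j => if i ≤ j then d j else 1),
    ← Finset.prod_mul_distrib, ← Finset.prod_pow]
  refine Finset.prod_congr rfl fun i _ => ?_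
  rw [Finset.prod_ite, Finset.prod_ite]
  simp only [Finset.prod_const, one_pow, mul_one]
  rw [← pow_add]
  congr 1
  have e1 : (Finset.univ.filter fun j : Fin m => i ≤ j) = Finset.Ici i := by ext; simp
  have e2 : (Finset.univ.filter fun j : Fin m => j ≤ i) = Finset.Iic i := by ext; simp
  rw [e1, e2, Fin.card_Ici, Fin.card_Iic]
  omega

/-- Conjugating a transvection by the diagonal matrix with a `2` in place `i` squares it. The
determinant is multiplicative and unchanged by conjugation, so it equals its own square, and it is
nonzero. -/
theorem det_congrUpper_transvection (t : Matrix.TransvectionStruct (Fin m) ℝ) :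
    LinearMap.det (congrUpper t.toMatrix) = 1 := by
  set D : Matrix (Fin m) (Fin m) ℝ → ℝ := fun g => LinearMap.det (congrUpper g) with hD
  have hmul : ∀ g h, D (g * h) = D g * D h := fun g h => by
    simp only [hD, congrUpper_mul, map_mul]
  have hone : D 1 = 1 := by simp only [hD, congrUpper_one, map_one]
  obtain ⟨i, j, hij, c⟩ := t
  change D (Matrix.transvection i j c) = 1
  set d : Fin m → ℝ := Function.update 1 i 2
  set e : Fin m → ℝ := Function.update 1 i 2⁻¹
  have hde : Matrix.diagonal d * Matrix.diagonal e = (1 : Matrix (Fin m) (Fin m) ℝ) := by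
    rw [Matrix.diagonal_mul_diagonal, ← Matrix.diagonal_one]
    congr 1
    ext k
    by_cases hk : k = i
    · subst hk; simp [d, e]
    · simp [d, e, hk]
  have h1 : Matrix.diagonal d * Matrix.transvection i j c * Matrix.diagonal e =
      Matrix.transvection i j c * Matrix.transvection i j c := by
    rw [Matrix.transvection_mul_transvection_same _ _ hij, Matrix.transvection, Matrix.mul_add,
      Matrix.add_mul, Matrix.mul_one, hde, Matrix.transvection]
    congr 1
    ext k l
    rw [Matrix.mul_diagonal, Matrix.diagonal_mul]
    by_cases hk : k = i
    · by_cases hl : l = j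
      · subst hk hl
        simp [d, e, hij.symm]
        ring
      · simp [Ne.symm hl]
    · simp [Ne.symm hk]
  have h2 : Matrix.transvection i j c * Matrix.transvection i j (-c) = 1 := by
    rw [Matrix.transvection_mul_transvection_same _ _ hij, add_neg_cancel,
      Matrix.transvection_zero]
  have h3 := congrArg D h1
  have h4 := congrArg D h2
  have h5 := congrArg D hde
  rw [hmul, hmul] at h3
  rw [hmul, hone] at h4 h5
  rw [hmul] at h3
  have h6 : D (Matrix.transvection i j c) ≠ 0 := left_ne_zero_of_mul_eq_one h4
  have : D (Matrix.transvection i j c) * D (Matrix.transvection i j c) =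
    D (Matrix.transvection i j c) * 1 := by
    rw [← h3, ← h5]; ring
  exact mul_left_cancel₀ h6 this

theorem det_congrUpper {g : Matrix (Fin m) (Fin m) ℝ} (hg : g.det ≠ 0) :
    LinearMap.det (congrUpper g) = g.det ^ (m + 1) := by
  refine Matrix.diagonal_transvection_induction_of_det_ne_zero
    (fun g => LinearMap.det (congrUpper g) = g.det ^ (m + 1)) g hg (fun D _ => ?_) (fun t => ?_)
    (fun A B _ _ hA hB => ?_)
  · rw [det_congrUpper_diagonal, Matrix.det_diagonal]
  · rw [det_congrUpper_transvection, Matrix.TransvectionStruct.det, one_pow]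
  · rw [congrUpper_mul, map_mul, hA, hB, Matrix.det_mul, mul_pow]

theorem map_congr_lebSym {g : Matrix (Fin m) (Fin m) ℝ} (hg : g.det ≠ 0) :
    (lebSym m).map (fun s => g * s * gᵀ) =
      ENNReal.ofReal (|g.det| ^ (m + 1))⁻¹ • lebSym m := by
  have hc : Continuous fun s : Matrix (Fin m) (Fin m) ℝ => g * s * gᵀ := by fun_prop
  have hdet : LinearMap.det (congrUpper g) ≠ 0 := by
    rw [det_congrUpper hg]; exact pow_ne_zero _ hg
  have h1 : (fun s : Matrix (Fin m) (Fin m) ℝ => g * s * gᵀ) ∘ symOfUpper =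
      symOfUpper ∘ congrUpper g := by
    ext1 t; exact (symOfUpper_congrUpper g t).symm
  rw [lebSym, Measure.map_map hc.measurable continuous_symOfUpper.measurable, h1,
    ← Measure.map_map continuous_symOfUpper.measurable
      (LinearMap.continuous_of_finiteDimensional _).measurable,
    Measure.map_linearMap_addHaar_eq_smul_addHaar _ hdet, Measure.map_smul, det_congrUpper hg,
    abs_inv, abs_pow]

/-- Measures on matrices that are invariant under all congruences `s ↦ g s gᵀ`. -/
def IsCongrInvariant (μ : Measure (Matrix (Fin m) (Fin m) ℝ)) : Prop :=
  ∀ g : Matrix (Fin m) (Fin m) ℝ, IsUnit g.det → μ.map (fun s => g * s * gᵀ) = μ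

theorem measurable_congr (g : Matrix (Fin m) (Fin m) ℝ) :
    Measurable fun s : Matrix (Fin m) (Fin m) ℝ => g * s * gᵀ :=
  Continuous.measurable (by fun_prop)

theorem IsCongrInvariant.lintegral_comp {μ : Measure (Matrix (Fin m) (Fin m) ℝ)}
    (hμ : IsCongrInvariant μ) {g : Matrix (Fin m) (Fin m) ℝ} (hg : IsUnit g.det)
    {f : Matrix (Fin m) (Fin m) ℝ → ENNReal} (hf : Measurable f) :
    ∫⁻ s, f (g * s * gᵀ) ∂μ = ∫⁻ s, f s ∂μ := by
  conv_rhs => rw [← hμ g hg]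
  rw [lintegral_map hf (measurable_congr g)]

theorem measurable_det_rpow (c : ℝ) :
    Measurable fun r : Matrix (Fin m) (Fin m) ℝ => ENNReal.ofReal (r.det ^ c) := by
  have : Continuous fun r : Matrix (Fin m) (Fin m) ℝ => r.det := by fun_prop
  exact (this.measurable.pow_const c).ennreal_ofReal

/-- The Jacobian `|det g|^{m+1}` cancels against `det(g s gᵀ)^{-(m+1)/2} = |det g|^{-(m+1)}
det(s)^{-(m+1)/2}`. -/
theorem dStar_isCongrInvariant : IsCongrInvariant (dStar m) := by
  intro g hg
  have hg0 : g.det ≠ 0 := hg.ne_zero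
  ext A hA
  rw [Measure.map_apply (measurable_congr g) hA, dStar,
    withDensity_apply _ ((measurable_congr g) hA), withDensity_apply _ hA,
    Measure.restrict_restrict ((measurable_congr g) hA), Measure.restrict_restrict hA,
    ← lintegral_indicator ((measurable_congr g hA).inter measurableSet_cone),
    ← lintegral_indicator (hA.inter measurableSet_cone)]
  set φ : Matrix (Fin m) (Fin m) ℝ → ENNReal := (A ∩ cone m).indicator
    fun r => ENNReal.ofReal (r.det ^ (-(((m : ℝ) + 1) / 2))) with hφ
  have hφm : Measurable φ := (measurable_det_rpow _).indicator (hA.inter measurableSet_cone)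
  have h1 : ∫⁻ s, φ (g * s * gᵀ) ∂(lebSym m) =
      ENNReal.ofReal (|g.det| ^ (m + 1))⁻¹ * ∫⁻ s, φ s ∂(lebSym m) := by
    rw [← lintegral_map hφm (measurable_congr g), map_congr_lebSym hg0, lintegral_smul_measure,
      smul_eq_mul]
  have h2 : ∀ s, ((fun s : Matrix (Fin m) (Fin m) ℝ => g * s * gᵀ) ⁻¹' A ∩ cone m).indicator
      (fun r => ENNReal.ofReal (r.det ^ (-(((m : ℝ) + 1) / 2)))) s =
      ENNReal.ofReal (|g.det| ^ (m + 1)) * φ (g * s * gᵀ) := fun s => by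
    by_cases hs : s.PosDef
    · have hgs : (g * s * gᵀ).PosDef := (posDef_congr_iff hg).2 hs
      by_cases hsA : g * s * gᵀ ∈ A
      · have hm1 : s ∈ (fun s : Matrix (Fin m) (Fin m) ℝ => g * s * gᵀ) ⁻¹' A ∩ cone m := ⟨hsA, hs⟩
        have hm2 : g * s * gᵀ ∈ A ∩ cone m := ⟨hsA, hgs⟩
        rw [Set.indicator_of_mem hm1, hφ, Set.indicator_of_mem hm2,
          ← ENNReal.ofReal_mul (by positivity)]
        congr 1
        have h3 : (g * s * gᵀ).det = |g.det| ^ 2 * s.det := by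
          rw [Matrix.det_mul, Matrix.det_mul, Matrix.det_transpose, sq_abs]; ring
        have h4 : 0 < |g.det| := abs_pos.2 hg0
        rw [h3, Real.mul_rpow (by positivity) hs.det_pos.le, ← mul_assoc, ← Real.rpow_natCast,
          ← Real.rpow_natCast, ← Real.rpow_mul h4.le, ← Real.rpow_add h4]
        have : ((m + 1 : ℕ) : ℝ) + ((2 : ℕ) : ℝ) * -(((m : ℝ) + 1) / 2) = 0 := by
          push_cast; ring
        rw [this, Real.rpow_zero, one_mul]
      · rw [Set.indicator_of_notMem (fun h => hsA h.1), hφ,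
          Set.indicator_of_notMem (fun h => hsA h.1), mul_zero]
    · have hgs : ¬ (g * s * gᵀ).PosDef := fun h => hs ((posDef_congr_iff hg).1 h)
      rw [Set.indicator_of_notMem (fun h => hs h.2), hφ,
          Set.indicator_of_notMem (fun h => hgs h.2), mul_zero]
  simp only [h2]
  rw [lintegral_const_mul' _ _ ENNReal.ofReal_ne_top, h1, ← mul_assoc,
    ← ENNReal.ofReal_mul (by positivity), mul_inv_cancel₀ (by positivity), ENNReal.ofReal_one,
    one_mul]

end MatrixWavelet

/-! ### The measure `|z|_m^{-n} dz`, its Gram image, and uniqueness of invariant measures. -/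

namespace MatrixWavelet

variable {n m : ℕ}

/-- Each of the `n` rows is transformed by `g` separately, whence the Jacobian `|det g|^n`. -/
theorem map_mul_transpose_volume (n : ℕ) {g : Matrix (Fin m) (Fin m) ℝ} (hg : g.det ≠ 0) :
    (volume : Measure (Matrix (Fin n) (Fin m) ℝ)).map (fun z => z * gᵀ) =
      ENNReal.ofReal (|g.det| ^ n)⁻¹ • volume := by
  set L : (Fin n → Fin m → ℝ) →ₗ[ℝ] (Fin n → Fin m → ℝ) :=
    LinearMap.pi fun i => Matrix.toLin' g ∘ₗ LinearMap.proj i with hL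
  have hdet : LinearMap.det L = g.det ^ n := by
    rw [hL, LinearMap.det_pi]
    simp
  have h := Measure.map_linearMap_addHaar_eq_smul_addHaar
    (volume : Measure (Fin n → Fin m → ℝ)) (f := L) (by rw [hdet]; exact pow_ne_zero _ hg)
  rw [hdet, abs_inv, abs_pow] at h
  have hfun : (fun z : Matrix (Fin n) (Fin m) ℝ => z * gᵀ) = L := by
    ext z i j
    change _ = (g *ᵥ z i) j
    simp only [Matrix.mul_apply, Matrix.transpose_apply, Matrix.mulVec, dotProduct]
    exact Finset.sum_congr rfl fun k _ => mul_comm _ _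
  rw [hfun]
  exact h

theorem continuous_matVol : Continuous (matVol (n := n) (m := m)) := by
  unfold matVol
  fun_prop

theorem matVol_nonneg (z : Matrix (Fin n) (Fin m) ℝ) : 0 ≤ matVol z := Real.sqrt_nonneg _

theorem matVol_mul_transpose (z : Matrix (Fin n) (Fin m) ℝ) (g : Matrix (Fin m) (Fin m) ℝ) :
    matVol (z * gᵀ) = |g.det| * matVol z := by
  have : (z * gᵀ)ᵀ * (z * gᵀ) = g * (zᵀ * z) * gᵀ := by
    rw [Matrix.transpose_mul, Matrix.transpose_transpose]; simp only [Matrix.mul_assoc]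
  rw [matVol, this, Matrix.det_mul, Matrix.det_mul, Matrix.det_transpose, matVol,
    ← Real.sqrt_sq_eq_abs, ← Real.sqrt_mul (sq_nonneg _)]
  congr 1; ring

theorem gram_posSemidef (z : Matrix (Fin n) (Fin m) ℝ) : (zᵀ * z).PosSemidef :=
  Matrix.posSemidef_conjTranspose_mul_self z

theorem gram_posDef_iff {z : Matrix (Fin n) (Fin m) ℝ} : (zᵀ * z).PosDef ↔ matVol z ≠ 0 := by
  rw [(gram_posSemidef z).posDef_iff_det_ne_zero, matVol, ne_eq, ne_eq,
    Real.sqrt_eq_zero (gram_posSemidef z).det_nonneg]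

/-- The measure `|z|_m^{-n} dz` on `n × m` matrices. -/
noncomputable def invVolume (n m : ℕ) : Measure (Matrix (Fin n) (Fin m) ℝ) :=
  volume.withDensity fun z => ENNReal.ofReal (matVol z ^ n)⁻¹

theorem measurable_invVolume_density :
    Measurable fun z : Matrix (Fin n) (Fin m) ℝ => ENNReal.ofReal (matVol z ^ n)⁻¹ :=
  ((continuous_matVol.pow n).measurable.inv).ennreal_ofReal

instance invVolume_sFinite : SFinite (invVolume n m) := by
  unfold invVolume; infer_instance

theorem measurable_mul_right {l : ℕ} (g : Matrix (Fin m) (Fin l) ℝ) :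
    Measurable fun z : Matrix (Fin n) (Fin m) ℝ => z * g :=
  Continuous.measurable (by fun_prop)

theorem lintegral_invVolume_mul_transpose {g : Matrix (Fin m) (Fin m) ℝ} (hg : IsUnit g.det)
    {φ : Matrix (Fin n) (Fin m) ℝ → ENNReal} (hφ : Measurable φ) :
    ∫⁻ z, φ (z * gᵀ) ∂(invVolume n m) = ∫⁻ z, φ z ∂(invVolume n m) := by
  have hpos : 0 < |g.det| := abs_pos.2 hg.ne_zero
  have hw := measurable_invVolume_density (n := n) (m := m)
  have hφg : Measurable fun z : Matrix (Fin n) (Fin m) ℝ => φ (z * gᵀ) :=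
    hφ.comp (measurable_mul_right _)
  rw [invVolume, lintegral_withDensity_eq_lintegral_mul _ hw hφ,
    lintegral_withDensity_eq_lintegral_mul _ hw hφg]
  set w : Matrix (Fin n) (Fin m) ℝ → ENNReal := fun z => ENNReal.ofReal (matVol z ^ n)⁻¹ with hwdef
  have h1 : ∫⁻ z : Matrix (Fin n) (Fin m) ℝ, (w * φ) (z * gᵀ) =
      ENNReal.ofReal (|g.det| ^ n)⁻¹ * ∫⁻ z : Matrix (Fin n) (Fin m) ℝ, (w * φ) z := by
    rw [← lintegral_map (hw.mul hφ) (measurable_mul_right _),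
      map_mul_transpose_volume n hg.ne_zero, lintegral_smul_measure, smul_eq_mul]
  have h2 : ∀ z : Matrix (Fin n) (Fin m) ℝ, (w * (fun z => φ (z * gᵀ) :
      Matrix (Fin n) (Fin m) ℝ → ENNReal)) z =
      ENNReal.ofReal (|g.det| ^ n) * (w * φ) (z * gᵀ) := fun z => by
    simp only [Pi.mul_apply, hwdef]
    rw [matVol_mul_transpose, ← mul_assoc, ← ENNReal.ofReal_mul (by positivity)]
    congr 2
    rw [mul_pow, mul_inv, ← mul_assoc, mul_inv_cancel₀ (by positivity), one_mul]
  simp only [h2]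
  rw [lintegral_const_mul' _ _ ENNReal.ofReal_ne_top, h1, ← mul_assoc,
    ← ENNReal.ofReal_mul (by positivity), mul_inv_cancel₀ (by positivity), ENNReal.ofReal_one,
    one_mul]

theorem ae_invVolume_posDef (hn : n ≠ 0) : ∀ᵐ z ∂(invVolume n m), (zᵀ * z).PosDef := by
  rw [invVolume, ae_withDensity_iff measurable_invVolume_density]
  -- Since `0⁻¹ = 0`, the density vanishes at rank-deficient matrices, which are therefore null for
  -- `invVolume`.
  refine Eventually.of_forall fun z hz => gram_posDef_iff.2 fun h0 => hz ?_
  rw [h0, zero_pow hn, inv_zero, ENNReal.ofReal_zero]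

theorem measurable_comp_congr {f : Matrix (Fin m) (Fin m) ℝ → ENNReal} (hf : Measurable f)
    (g : Matrix (Fin m) (Fin m) ℝ) : Measurable fun s => f (g * s * gᵀ) :=
  hf.comp (measurable_congr g)

/-- The image of `|z|_m^{-n} dz` under `z ↦ zᵀz`. -/
noncomputable def gramMeasure (n m : ℕ) : Measure (Matrix (Fin m) (Fin m) ℝ) :=
  (invVolume n m).map fun z => zᵀ * z

theorem measurable_gram : Measurable fun z : Matrix (Fin n) (Fin m) ℝ => zᵀ * z :=
  Continuous.measurable (by fun_prop)

instance gramMeasure_sFinite : SFinite (gramMeasure n m) := by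
  unfold gramMeasure; infer_instance

instance dStar_sFinite : SFinite (dStar m) := by
  unfold dStar lebSym; infer_instance

theorem ae_dStar_posDef : ∀ᵐ s ∂(dStar m), s.PosDef := by
  have : dStar m ≪ (lebSym m).restrict (cone m) := withDensity_absolutelyContinuous _ _
  exact this.ae_le (ae_restrict_mem measurableSet_cone)

theorem ae_gramMeasure_posDef (hn : n ≠ 0) : ∀ᵐ s ∂(gramMeasure n m), s.PosDef :=
  (ae_map_iff measurable_gram.aemeasurable measurableSet_cone).2 (ae_invVolume_posDef hn)

theorem gramMeasure_isCongrInvariant : IsCongrInvariant (gramMeasure n m) := by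
  intro g hg
  refine Measure.ext_of_lintegral _ fun f hf => ?_
  have hfg : Measurable fun z : Matrix (Fin n) (Fin m) ℝ => f (zᵀ * z) := hf.comp measurable_gram
  rw [lintegral_map hf (measurable_congr g), gramMeasure,
    lintegral_map (measurable_comp_congr hf g) measurable_gram, lintegral_map hf measurable_gram,
    ← lintegral_invVolume_mul_transpose hg hfg]
  refine lintegral_congr fun z => ?_
  simp only [Matrix.transpose_mul, Matrix.transpose_transpose,
    Matrix.mul_assoc]

theorem measurable_matrix_inv :
    Measurable fun g : Matrix (Fin m) (Fin m) ℝ => g⁻¹ := by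
  have h : (fun g : Matrix (Fin m) (Fin m) ℝ => g⁻¹) = fun g => g.det⁻¹ • g.adjugate := by
    ext1 g; rw [Matrix.inv_def, Ring.inverse_eq_inv']
  have h1 : Measurable fun g : Matrix (Fin m) (Fin m) ℝ => g.det :=
    Continuous.measurable (by fun_prop)
  have h2 : Measurable fun g : Matrix (Fin m) (Fin m) ℝ => g.adjugate :=
    Continuous.measurable (continuous_id.matrix_adjugate)
  rw [h]
  exact h1.inv.smul h2

/-- A neighbourhood of the identity in the cone, of finite invariant measure, that is stable under
inversion and under exchanging `A Aᵀ` with `Aᵀ A`. -/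
def testSet (m : ℕ) : Set (Matrix (Fin m) (Fin m) ℝ) :=
  {p | (p.trace < m + 1 ∧ p.det < 2) ∧ (p⁻¹.trace < m + 1 ∧ p⁻¹.det < 2)}

theorem measurableSet_testSet : MeasurableSet (testSet m) := by
  have h1 : MeasurableSet {p : Matrix (Fin m) (Fin m) ℝ | p.trace < m + 1 ∧ p.det < 2} :=
    ((isOpen_lt (Continuous.matrix_trace continuous_id) continuous_const).inter
      (isOpen_lt (Continuous.matrix_det continuous_id) continuous_const)).measurableSet
  exact h1.inter (measurable_matrix_inv h1)

theorem mul_transpose_mem_testSet_iff (A : Matrix (Fin m) (Fin m) ℝ) :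
    A * Aᵀ ∈ testSet m ↔ Aᵀ * A ∈ testSet m := by
  simp only [testSet, Set.mem_ofPred_eq, Matrix.mul_inv_rev, Matrix.trace_mul_comm A,
    Matrix.trace_mul_comm A⁻¹, Matrix.det_mul, mul_comm]

theorem inv_mem_testSet_iff {p : Matrix (Fin m) (Fin m) ℝ} (hp : IsUnit p.det) :
    p⁻¹ ∈ testSet m ↔ p ∈ testSet m := by
  simp only [testSet, Set.mem_ofPred_eq, Matrix.nonsing_inv_nonsing_inv p hp]
  exact and_comm

/-- For `A = g x^{-1/2}` the matrix `A Aᵀ = g x⁻¹ gᵀ` is the inverse of `g⁻ᵀ x g⁻¹`, so the two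
symmetries of `testSet` apply in turn. This makes the test function depend on `x` through a
congruence, where invariance can act. -/
theorem testSet_exchange {x g : Matrix (Fin m) (Fin m) ℝ} (hx : x.PosDef) (hg : IsUnit g.det) :
    (g * (msqrt x)⁻¹ᵀ)ᵀ * (g * (msqrt x)⁻¹ᵀ) ∈ testSet m ↔
      g⁻¹ᵀ * x * g⁻¹ᵀᵀ ∈ testSet m := by
  have h1 : g * (msqrt x)⁻¹ᵀ * (g * (msqrt x)⁻¹ᵀ)ᵀ = (g⁻¹ᵀ * x * g⁻¹ᵀᵀ)⁻¹ := by
    conv_rhs => rw [← msqrt_mul_self hx.posSemidef]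
    simp only [Matrix.mul_inv_rev, Matrix.transpose_mul, Matrix.transpose_transpose,
      Matrix.nonsing_inv_nonsing_inv g hg, Matrix.transpose_nonsing_inv, transpose_msqrt,
      Matrix.nonsing_inv_nonsing_inv gᵀ (by rwa [Matrix.det_transpose]), Matrix.mul_assoc]
  have hu : IsUnit (g⁻¹ᵀ * x * g⁻¹ᵀᵀ).det := by
    have : IsUnit g⁻¹.det := by rw [Matrix.isUnit_nonsing_inv_det_iff]; exact hg
    rw [Matrix.det_mul, Matrix.det_mul, Matrix.det_transpose, Matrix.det_transpose,
      Matrix.det_transpose]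
    exact (this.mul hx.det_pos.ne'.isUnit).mul this
  rw [← mul_transpose_mem_testSet_iff, h1, inv_mem_testSet_iff hu]

theorem isUnit_det_of_gram_posDef {g : Matrix (Fin m) (Fin m) ℝ} (hg : (gᵀ * g).PosDef) :
    IsUnit g.det := by
  have := hg.det_pos
  rw [Matrix.det_mul, Matrix.det_transpose] at this
  exact (mul_self_pos.1 this).isUnit

/-- Comparison of an invariant measure on the cone with Haar measure on `GL_m`. -/
theorem lintegral_mul_invVolume_testSet (hm : m ≠ 0)
    {μ : Measure (Matrix (Fin m) (Fin m) ℝ)} [SFinite μ] (hμ : IsCongrInvariant μ)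
    (hpos : ∀ᵐ s ∂μ, s.PosDef) {f : Matrix (Fin m) (Fin m) ℝ → ENNReal} (hf : Measurable f) :
    (∫⁻ s, f s ∂μ) * invVolume m m {g | gᵀ * g ∈ testSet m} =
      μ (testSet m) * ∫⁻ g, f (g * gᵀ) ∂(invVolume m m) := by
  set χ : Matrix (Fin m) (Fin m) ℝ → ENNReal := (testSet m).indicator 1 with hχ
  have hχm : Measurable χ := measurable_one.indicator measurableSet_testSet
  have hunit : ∀ᵐ g ∂(invVolume m m), IsUnit g.det :=
    (ae_invVolume_posDef hm).mono fun g hg => isUnit_det_of_gram_posDef hg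
  have hunitinv : ∀ {g : Matrix (Fin m) (Fin m) ℝ}, IsUnit g.det → IsUnit g⁻¹ᵀ.det := fun hg => by
    rw [Matrix.det_transpose, Matrix.isUnit_nonsing_inv_det_iff]; exact hg
  have hcont : Continuous fun p : Matrix (Fin m) (Fin m) ℝ × Matrix (Fin m) (Fin m) ℝ =>
    p.1 * p.2 * p.1ᵀ := by fun_prop
  -- The double integral of `χ(gᵀg) f(g s gᵀ)` is computed in two ways. With `s` innermost,
  -- invariance of `μ` removes `g` from the inner integral.
  have e1 : ∫⁻ g, χ (gᵀ * g) * ∫⁻ s, f (g * s * gᵀ) ∂μ ∂(invVolume m m) =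
      (∫⁻ s, f s ∂μ) * invVolume m m {g | gᵀ * g ∈ testSet m} := by
    have : ∀ᵐ g ∂(invVolume m m), χ (gᵀ * g) * ∫⁻ s, f (g * s * gᵀ) ∂μ =
        {g : Matrix (Fin m) (Fin m) ℝ | gᵀ * g ∈ testSet m}.indicator
          (fun _ => ∫⁻ s, f s ∂μ) g := by
      filter_upwards [hunit] with g hg
      rw [hμ.lintegral_comp hg hf]
      by_cases h : gᵀ * g ∈ testSet m
      · rw [hχ, Set.indicator_of_mem h, Set.indicator_of_mem (by exact h), Pi.one_apply, one_mul]
      · rw [hχ, Set.indicator_of_notMem h, Set.indicator_of_notMem (by exact h), zero_mul]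
    rw [lintegral_congr_ae this]
    exact lintegral_indicator_const (measurable_gram measurableSet_testSet) _
  have e2 : ∫⁻ g, χ (gᵀ * g) * ∫⁻ s, f (g * s * gᵀ) ∂μ ∂(invVolume m m) =
      ∫⁻ s, ∫⁻ g, χ (gᵀ * g) * f (g * s * gᵀ) ∂(invVolume m m) ∂μ := by
    rw [← lintegral_lintegral_swap]
    · refine lintegral_congr fun g => ?_
      rw [lintegral_const_mul _ (measurable_comp_congr hf g)]
    · exact ((hχm.comp (measurable_gram.comp measurable_fst)).mul
        (hf.comp hcont.measurable)).aemeasurable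
  -- With `g` innermost, the substitution `g ↦ g s^{-1/2}` turns `g s gᵀ` into `g gᵀ` and moves `s`
  -- into `χ`.
  have e3 : ∫⁻ s, ∫⁻ g, χ (gᵀ * g) * f (g * s * gᵀ) ∂(invVolume m m) ∂μ =
      ∫⁻ s, ∫⁻ g, f (g * gᵀ) * χ (g⁻¹ᵀ * s * g⁻¹ᵀᵀ) ∂(invVolume m m) ∂μ := by
    refine lintegral_congr_ae (hpos.mono fun s hs => ?_)
    have hs' : IsUnit (msqrt s)⁻¹.det := by
      rw [Matrix.isUnit_nonsing_inv_det_iff]; exact isUnit_det_msqrt hs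
    dsimp only
    rw [← lintegral_invVolume_mul_transpose hs' (φ := fun g => χ (gᵀ * g) * f (g * s * gᵀ))
      ((hχm.comp measurable_gram).mul (hf.comp (Continuous.measurable (by fun_prop))))]
    refine lintegral_congr_ae (hunit.mono fun g hg => ?_)
    have h1 : g * (msqrt s)⁻¹ᵀ * s * (g * (msqrt s)⁻¹ᵀ)ᵀ = g * gᵀ := by
      have h2 : (msqrt s)⁻¹ * s * (msqrt s)⁻¹ = 1 := by
        have h4 : (msqrt s)⁻¹ * s = (msqrt s)⁻¹ * (msqrt s * msqrt s) := by
          rw [msqrt_mul_self hs.posSemidef]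
        rw [h4, ← Matrix.mul_assoc, Matrix.nonsing_inv_mul _ (isUnit_det_msqrt hs), Matrix.one_mul,
          Matrix.mul_nonsing_inv _ (isUnit_det_msqrt hs)]
      rw [Matrix.transpose_mul, Matrix.transpose_transpose, Matrix.transpose_nonsing_inv,
        transpose_msqrt]
      calc g * (msqrt s)⁻¹ * s * ((msqrt s)⁻¹ * gᵀ)
          = g * ((msqrt s)⁻¹ * s * (msqrt s)⁻¹) * gᵀ := by simp only [Matrix.mul_assoc]
        _ = g * gᵀ := by rw [h2, Matrix.mul_one]
    have h3 : χ ((g * (msqrt s)⁻¹ᵀ)ᵀ * (g * (msqrt s)⁻¹ᵀ)) = χ (g⁻¹ᵀ * s * g⁻¹ᵀᵀ) := by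
      by_cases h : g⁻¹ᵀ * s * g⁻¹ᵀᵀ ∈ testSet m
      · rw [hχ, Set.indicator_of_mem h, Set.indicator_of_mem ((testSet_exchange hs hg).2 h)]
        rfl
      · rw [hχ, Set.indicator_of_notMem h,
          Set.indicator_of_notMem (fun h' => h ((testSet_exchange hs hg).1 h'))]
    dsimp only
    rw [h1, h3, mul_comm]
  -- After another exchange, invariance of `μ` under the congruence by `g⁻ᵀ` leaves `μ (testSet m)`.
  have e4 : ∫⁻ s, ∫⁻ g, f (g * gᵀ) * χ (g⁻¹ᵀ * s * g⁻¹ᵀᵀ) ∂(invVolume m m) ∂μ =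
      μ (testSet m) * ∫⁻ g, f (g * gᵀ) ∂(invVolume m m) := by
    have hinv : Measurable fun g : Matrix (Fin m) (Fin m) ℝ => g⁻¹ᵀ :=
      (Continuous.measurable (by fun_prop : Continuous fun g : Matrix (Fin m) (Fin m) ℝ => gᵀ)).comp
        measurable_matrix_inv
    have hfm : Measurable fun g : Matrix (Fin m) (Fin m) ℝ => f (g * gᵀ) :=
      hf.comp (Continuous.measurable (by fun_prop))
    rw [lintegral_lintegral_swap, ← lintegral_const_mul _ hfm]
    · refine lintegral_congr_ae (hunit.mono fun g hg => ?_)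
      dsimp only
      rw [lintegral_const_mul _ (measurable_comp_congr hχm _),
        hμ.lintegral_comp (hunitinv hg) hχm, hχ, lintegral_indicator_one measurableSet_testSet,
        mul_comm]
    · exact ((hfm.comp measurable_snd).mul
        (hχm.comp (hcont.measurable.comp ((hinv.comp measurable_snd).prodMk measurable_fst)))).aemeasurable
  rw [← e1, e2, e3, e4]

end MatrixWavelet

/-! ### Frobenius coordinates, the Gaussian integral, and the size of the test set. -/

namespace MatrixWavelet

variable {n m : ℕ}

/-- Matrices as vectors of a Euclidean space, with the Frobenius inner product. -/
noncomputable def matEuclid (n m : ℕ) :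
    Matrix (Fin n) (Fin m) ℝ ≃ₜ EuclideanSpace ℝ (Fin n × Fin m) where
  toFun z := WithLp.toLp 2 fun p => z p.1 p.2
  invFun v := Matrix.of fun i j => v (i, j)
  left_inv _ := rfl
  right_inv _ := rfl
  continuous_toFun := by fun_prop
  continuous_invFun := by fun_prop

theorem matEuclid_sub (x y : Matrix (Fin n) (Fin m) ℝ) :
    matEuclid n m (x - y) = matEuclid n m x - matEuclid n m y := rfl

theorem inner_matEuclid (x y : Matrix (Fin n) (Fin m) ℝ) :
    inner ℝ (matEuclid n m x) (matEuclid n m y) = (yᵀ * x).trace := by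
  change inner ℝ (WithLp.toLp 2 _) (WithLp.toLp 2 _) = _
  rw [EuclideanSpace.inner_toLp_toLp]
  simp only [dotProduct, Matrix.trace, Matrix.diag, Matrix.mul_apply, Matrix.transpose_apply,
    Pi.star_apply, star_trivial, Fintype.sum_prod_type]
  rw [Finset.sum_comm]

theorem matEuclid_measurePreserving : MeasurePreserving (matEuclid n m) := by
  refine (PiLp.volume_preserving_toLp (Fin n × Fin m)).comp
    (g := WithLp.toLp 2) (f := fun z : Matrix (Fin n) (Fin m) ℝ => fun p => z p.1 p.2) ?_
  have hc : Continuous fun z : Matrix (Fin n) (Fin m) ℝ => fun p : Fin n × Fin m => z p.1 p.2 := by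
    fun_prop
  refine ⟨hc.measurable, ?_⟩
  refine (Measure.pi_eq fun s hs => ?_).symm
  rw [Measure.map_apply hc.measurable (MeasurableSet.univ_pi hs)]
  have : (fun z : Matrix (Fin n) (Fin m) ℝ => fun p : Fin n × Fin m => z p.1 p.2) ⁻¹'
      Set.univ.pi s = (Set.univ.pi fun i => Set.univ.pi fun j => s (i, j) :
        Set (Fin n → Fin m → ℝ)) := by
    ext z
    exact ⟨fun h i _ j _ => h (i, j) trivial, fun h p _ => h p.1 trivial p.2 trivial⟩
  rw [this]
  change (volume : Measure (Fin n → Fin m → ℝ)) _ = _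
  rw [volume_pi_pi, Fintype.prod_prod_type]
  simp only [volume_pi_pi]

theorem trace_gram_eq_norm_sq (z : Matrix (Fin n) (Fin m) ℝ) :
    (zᵀ * z).trace = ‖matEuclid n m z‖ ^ 2 := by
  rw [← inner_matEuclid, real_inner_self_eq_norm_sq]

theorem integral_exp_neg_trace_gram :
    ∫ z : Matrix (Fin n) (Fin m) ℝ, Real.exp (-(zᵀ * z).trace) =
      Real.pi ^ ((n : ℝ) * m / 2) := by
  have h := GaussianFourier.integral_rexp_neg_mul_sq_norm
    (V := EuclideanSpace ℝ (Fin n × Fin m)) one_pos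
  rw [← (matEuclid_measurePreserving (n := n) (m := m)).integral_comp
    (matEuclid n m).measurableEmbedding] at h
  simp only [trace_gram_eq_norm_sq]
  simpa using h

theorem lintegral_exp_neg_trace_gram :
    ∫⁻ z : Matrix (Fin n) (Fin m) ℝ, ENNReal.ofReal (Real.exp (-(zᵀ * z).trace)) =
      ENNReal.ofReal (Real.pi ^ ((n : ℝ) * m / 2)) := by
  rw [← integral_exp_neg_trace_gram, ofReal_integral_eq_lintegral_ofReal]
  -- A non-integrable function would have Bochner integral `0`, but the value found is positive.
  · by_contra h
    have := integral_undef h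
    rw [integral_exp_neg_trace_gram] at this
    exact (Real.rpow_pos_of_pos Real.pi_pos _).ne' this
  · exact Eventually.of_forall fun z => (Real.exp_pos _).le

/-- The invariant measure of a set on which the trace is bounded above and the determinant
is bounded below is finite. -/
theorem dStar_lt_top_of_bounds {A : Set (Matrix (Fin m) (Fin m) ℝ)} {R δ : ℝ} (hδ : 0 < δ)
    (hA : ∀ s ∈ A, s.PosDef → s.trace ≤ R ∧ δ ≤ s.det) : dStar m A < ⊤ := by
  have hB : lebSym m {s | ∀ i j, |s i j| ≤ R} < ⊤ := by
    have hm : MeasurableSet {s : Matrix (Fin m) (Fin m) ℝ | ∀ i j, |s i j| ≤ R} := by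
      simp only [Set.ofPred_forall]
      refine (isClosed_iInter fun i => isClosed_iInter fun j => ?_).measurableSet
      exact isClosed_le (by fun_prop) continuous_const
    rw [lebSym, Measure.map_apply continuous_symOfUpper.measurable hm]
    refine lt_of_le_of_lt (measure_mono ?_)
      (measure_Icc_lt_top (a := fun _ => -R) (b := fun _ => R))
    intro t ht
    have : ∀ p, |t p| ≤ R := fun p => by
      rw [← upperOfSym_symOfUpper t]; exact ht _ _
    exact ⟨fun p => (abs_le.1 (this p)).1, fun p => (abs_le.1 (this p)).2⟩
  set C : Set (Matrix (Fin m) (Fin m) ℝ) := {s | s.trace ≤ R ∧ δ ≤ s.det} with hC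
  have hCm : MeasurableSet C :=
    ((isClosed_le (Continuous.matrix_trace continuous_id) continuous_const).inter
      (isClosed_le continuous_const (Continuous.matrix_det continuous_id))).measurableSet
  have h1 : dStar m A ≤ dStar m C := by
    refine measure_mono_ae (ae_dStar_posDef.mono fun s hs hsA => hA s hsA hs)
  refine h1.trans_lt ?_
  rw [dStar, withDensity_apply _ hCm, Measure.restrict_restrict hCm]
  have h2 : ∫⁻ s in C ∩ cone m, ENNReal.ofReal (s.det ^ (-(((m : ℝ) + 1) / 2))) ∂(lebSym m) ≤
      ∫⁻ _ in C ∩ cone m, ENNReal.ofReal (δ ^ (-(((m : ℝ) + 1) / 2))) ∂(lebSym m) := by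
    refine setLIntegral_mono' (hCm.inter measurableSet_cone) fun s hs => ?_
    refine ENNReal.ofReal_le_ofReal (Real.rpow_le_rpow_of_nonpos hδ hs.1.2 ?_)
    have : (0 : ℝ) ≤ m := Nat.cast_nonneg m
    linarith
  refine h2.trans_lt ?_
  rw [setLIntegral_const]
  refine ENNReal.mul_lt_top ENNReal.ofReal_lt_top ((measure_mono ?_).trans_lt hB)
  intro s hs i j
  exact (abs_entry_le_trace hs.2.posSemidef i j).trans hs.1.1

theorem det_ge_of_mem_testSet {p : Matrix (Fin m) (Fin m) ℝ} (hp : p ∈ testSet m)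
    (hdet : 0 < p.det) : 1 / 2 ≤ p.det := by
  have h := hp.2.2
  rw [Matrix.det_nonsing_inv, Ring.inverse_eq_inv'] at h
  rw [div_le_iff₀ two_pos]
  have := mul_inv_cancel₀ hdet.ne'
  nlinarith

theorem dStar_testSet_lt_top : dStar m (testSet m) < ⊤ :=
  dStar_lt_top_of_bounds (R := m + 1) (δ := 1 / 2) (by norm_num) fun _ hs hpos =>
    ⟨hs.1.1.le, det_ge_of_mem_testSet hs hpos.det_pos⟩

/-- On the preimage the trace bound confines `z` to a Frobenius ball, and `det ≥ 1/2` bounds the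
density. -/
theorem gramMeasure_testSet_lt_top (hn : n ≠ 0) : gramMeasure n m (testSet m) < ⊤ := by
  rw [gramMeasure, Measure.map_apply measurable_gram measurableSet_testSet]
  set C : Set (Matrix (Fin n) (Fin m) ℝ) :=
    {z | (zᵀ * z).trace ≤ m + 1 ∧ 1 / 2 ≤ (zᵀ * z).det} with hC
  have hgc : Continuous fun z : Matrix (Fin n) (Fin m) ℝ => zᵀ * z := by fun_prop
  have hCm : MeasurableSet C :=
    ((isClosed_le hgc.matrix_trace continuous_const).inter
      (isClosed_le continuous_const hgc.matrix_det)).measurableSet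
  have h1 : invVolume n m ((fun z => zᵀ * z) ⁻¹' testSet m) ≤ invVolume n m C :=
    measure_mono_ae ((ae_invVolume_posDef hn).mono fun z hz hzt =>
      ⟨hzt.1.1.le, det_ge_of_mem_testSet hzt hz.det_pos⟩)
  refine h1.trans_lt ?_
  rw [invVolume, withDensity_apply _ hCm]
  have h2 : ∫⁻ z in C, ENNReal.ofReal (matVol z ^ n)⁻¹ ≤
      ∫⁻ _ in C, ENNReal.ofReal (Real.sqrt (1 / 2) ^ n)⁻¹ := by
    refine setLIntegral_mono' hCm fun z hz => ENNReal.ofReal_le_ofReal ?_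
    have : Real.sqrt (1 / 2) ≤ matVol z := Real.sqrt_le_sqrt hz.2
    have h0 : 0 < Real.sqrt (1 / 2) := Real.sqrt_pos.2 (by norm_num)
    gcongr
  refine h2.trans_lt ?_
  rw [setLIntegral_const]
  refine ENNReal.mul_lt_top ENNReal.ofReal_lt_top ?_
  have h3 : C ⊆ matEuclid n m ⁻¹' Metric.closedBall 0 (Real.sqrt (m + 1)) := fun z hz => by
    rw [Set.mem_preimage, mem_closedBall_zero_iff]
    refine Real.le_sqrt_of_sq_le ?_
    rw [← trace_gram_eq_norm_sq]
    exact hz.1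
  refine (measure_mono h3).trans_lt ?_
  rw [matEuclid_measurePreserving.measure_preimage
    Metric.isClosed_closedBall.measurableSet.nullMeasurableSet]
  exact measure_closedBall_lt_top

theorem eventually_mem_testSet {X : Type*} [TopologicalSpace X]
    {F : X → Matrix (Fin m) (Fin m) ℝ} {x : X} (hF : ContinuousAt F x) (hx : F x = 1) :
    ∀ᶠ y in 𝓝 x, F y ∈ testSet m := by
  have h1 : ContinuousAt (fun p : Matrix (Fin m) (Fin m) ℝ => p⁻¹) 1 := by
    have : (fun p : Matrix (Fin m) (Fin m) ℝ => p⁻¹) = fun p => p.det⁻¹ • p.adjugate := by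
      ext1 p; rw [Matrix.inv_def, Ring.inverse_eq_inv']
    rw [this]
    have hadj : Continuous fun p : Matrix (Fin m) (Fin m) ℝ => p.adjugate :=
      continuous_id.matrix_adjugate
    have hdet : ContinuousAt (fun p : Matrix (Fin m) (Fin m) ℝ => p.det⁻¹) 1 := by
      refine ContinuousAt.inv₀ (f := fun p : Matrix (Fin m) (Fin m) ℝ => p.det) ?_ (by simp)
      exact (Continuous.matrix_det continuous_id).continuousAt
    exact hdet.smul hadj.continuousAt
  have htr : Continuous fun p : Matrix (Fin m) (Fin m) ℝ => p.trace :=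
    Continuous.matrix_trace continuous_id
  have hdet : Continuous fun p : Matrix (Fin m) (Fin m) ℝ => p.det :=
    Continuous.matrix_det continuous_id
  have hU : ∀ᶠ p in 𝓝 (1 : Matrix (Fin m) (Fin m) ℝ), p.trace < (m : ℝ) + 1 ∧ p.det < 2 := by
    refine (htr.continuousAt.eventually_lt continuousAt_const ?_).and
      (hdet.continuousAt.eventually_lt continuousAt_const ?_)
    · simp
    · simp
  have hU' : ∀ᶠ p in 𝓝 (1 : Matrix (Fin m) (Fin m) ℝ), p ∈ testSet m := by
    have h2 : ∀ᶠ p in 𝓝 ((1 : Matrix (Fin m) (Fin m) ℝ)⁻¹),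
        p.trace < (m : ℝ) + 1 ∧ p.det < 2 := by rwa [inv_one]
    exact hU.and (h1.eventually h2)
  exact hF.eventually (by rwa [hx])

/-- The matrix of the inclusion of `ℝ^m` in `ℝ^n`. -/
def stdEmb (n m : ℕ) : Matrix (Fin n) (Fin m) ℝ :=
  Matrix.of fun i j => if i.val = j.val then 1 else 0

theorem stdEmb_gram (hmn : m ≤ n) : (stdEmb n m)ᵀ * stdEmb n m = 1 := by
  ext i j
  simp only [stdEmb, Matrix.mul_apply, Matrix.transpose_apply, Matrix.of_apply]
  rw [Finset.sum_eq_single (Fin.castLE hmn i)]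
  · simp [Matrix.one_apply, Fin.ext_iff]
  · intro k _ hk
    have : k.val ≠ i.val := fun h => hk (Fin.ext h)
    simp [this]
  · simp

theorem gramMeasure_testSet_pos (hmn : m ≤ n) : gramMeasure n m (testSet m) ≠ 0 := by
  rw [gramMeasure, Measure.map_apply measurable_gram measurableSet_testSet, invVolume, ne_eq,
    withDensity_apply_eq_zero measurable_invVolume_density]
  have hc : ContinuousAt (fun z : Matrix (Fin n) (Fin m) ℝ => zᵀ * z) (stdEmb n m) :=
    Continuous.continuousAt (by fun_prop)
  have h1 := eventually_mem_testSet hc (stdEmb_gram hmn)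
  have h2 : ∀ᶠ z in 𝓝 (stdEmb n m), matVol z ≠ 0 := by
    refine continuous_matVol.continuousAt.eventually_ne ?_
    rw [matVol, stdEmb_gram hmn]; simp
  refine (Measure.measure_pos_of_mem_nhds volume (x := stdEmb n m) ?_).ne'
  filter_upwards [h1, h2] with z hz1 hz2
  refine ⟨?_, hz1⟩
  have : 0 < matVol z := lt_of_le_of_ne (matVol_nonneg z) hz2.symm
  change ENNReal.ofReal _ ≠ 0
  rw [ne_eq, ENNReal.ofReal_eq_zero, not_le]
  positivity

/-- The perturbation of the quadratic form is at most `(∑|x_i|)² / (m + 1) ≤ m/(m + 1) · |x|²`, less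
than `|x|²`. It shows that the cone contains a neighbourhood of `1` among symmetric matrices. -/
theorem posDef_of_near_one {s : Matrix (Fin m) (Fin m) ℝ} (hs : s.IsHermitian)
    (h : ∀ i j, |(s - 1) i j| ≤ 1 / (m + 1)) : s.PosDef := by
  refine Matrix.PosDef.of_dotProduct_mulVec_pos hs fun x hx => ?_
  set S : ℝ := ∑ i, x i ^ 2 with hS
  have hSpos : 0 < S := by
    obtain ⟨i, hi⟩ := Function.ne_iff.1 hx
    exact Finset.sum_pos' (fun _ _ => sq_nonneg _) ⟨i, Finset.mem_univ i, by
      have : x i ≠ 0 := hi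
      positivity⟩
  have h1 : star x ⬝ᵥ s *ᵥ x = S + ∑ i, ∑ j, x i * (s - 1) i j * x j := by
    have : s *ᵥ x = x + (s - 1) *ᵥ x := by rw [Matrix.sub_mulVec, Matrix.one_mulVec]; abel
    rw [this, dotProduct_add, star_trivial]
    congr 1
    · simp only [dotProduct, hS, sq]
    · simp only [dotProduct, Matrix.mulVec, Finset.mul_sum, mul_assoc]
  have h2 : ∀ i j, -(1 / ((m : ℝ) + 1) * (|x i| * |x j|)) ≤ x i * (s - 1) i j * x j :=
    fun i j => by
    have : |x i * (s - 1) i j * x j| ≤ 1 / ((m : ℝ) + 1) * (|x i| * |x j|) := by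
      rw [abs_mul, abs_mul]
      calc |x i| * |(s - 1) i j| * |x j| = |(s - 1) i j| * (|x i| * |x j|) := by ring
        _ ≤ _ := by gcongr; exact h i j
    exact (abs_le.1 this).1
  have h3 : -(1 / ((m : ℝ) + 1) * (∑ i, |x i|) ^ 2) ≤ ∑ i, ∑ j, x i * (s - 1) i j * x j := by
    rw [sq, Finset.sum_mul_sum, Finset.mul_sum, ← Finset.sum_neg_distrib]
    refine Finset.sum_le_sum fun i _ => ?_
    rw [Finset.mul_sum, ← Finset.sum_neg_distrib]
    exact Finset.sum_le_sum fun j _ => h2 i j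
  have h4 : (∑ i, |x i|) ^ 2 ≤ m * S := by
    have := sq_sum_le_card_mul_sum_sq (s := Finset.univ) (f := fun i => |x i|)
    simpa [sq_abs] using this
  have h5 : 1 / ((m : ℝ) + 1) * (∑ i, |x i|) ^ 2 ≤ 1 / ((m : ℝ) + 1) * (m * S) := by gcongr
  have h6 : S - 1 / ((m : ℝ) + 1) * (m * S) = S / (m + 1) := by field_simp; ring
  have h7 : 0 < S / ((m : ℝ) + 1) := by positivity
  rw [h1]
  linarith

theorem dStar_testSet_pos : dStar m (testSet m) ≠ 0 := by
  rw [dStar, ne_eq, withDensity_apply_eq_zero (measurable_det_rpow _)]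
  have hmd : MeasurableSet {s : Matrix (Fin m) (Fin m) ℝ |
      ENNReal.ofReal (s.det ^ (-(((m : ℝ) + 1) / 2))) ≠ 0} :=
    measurable_det_rpow _ (measurableSet_singleton 0).compl
  rw [Measure.restrict_apply (hmd.inter measurableSet_testSet), lebSym,
    Measure.map_apply continuous_symOfUpper.measurable
      ((hmd.inter measurableSet_testSet).inter measurableSet_cone)]
  have h0 : symOfUpper (upperOfSym (1 : Matrix (Fin m) (Fin m) ℝ)) = 1 :=
    symOfUpper_upperOfSym Matrix.isHermitian_one
  have h1 := eventually_mem_testSet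
    (continuous_symOfUpper.continuousAt (x := upperOfSym (1 : Matrix (Fin m) (Fin m) ℝ))) h0
  have h2 : ∀ᶠ t in 𝓝 (upperOfSym (1 : Matrix (Fin m) (Fin m) ℝ)), (symOfUpper t).PosDef := by
    have : ∀ᶠ t in 𝓝 (upperOfSym (1 : Matrix (Fin m) (Fin m) ℝ)),
        ∀ i j, |(symOfUpper t - 1) i j| < 1 / (m + 1) := by
      refine eventually_all.2 fun i => eventually_all.2 fun j => ?_
      have hc : Continuous fun t => |(symOfUpper (m := m) t - 1) i j| :=
        (((continuous_symOfUpper.sub continuous_const).matrix_elem i j)).abs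
      refine hc.continuousAt.eventually_lt continuousAt_const ?_
      rw [h0]; simp; positivity
    exact this.mono fun t ht =>
      posDef_of_near_one (isHermitian_symOfUpper t) fun i j => (ht i j).le
  refine (Measure.measure_pos_of_mem_nhds volume (x := upperOfSym (1 : Matrix (Fin m) (Fin m) ℝ)) ?_).ne'
  filter_upwards [h1, h2] with t ht1 ht2
  refine ⟨⟨?_, ht1⟩, ht2⟩
  change ENNReal.ofReal _ ≠ 0
  rw [ne_eq, ENNReal.ofReal_eq_zero, not_le]
  exact Real.rpow_pos_of_pos ht2.det_pos _

end MatrixWavelet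

/-! ### Full rank almost everywhere, and polar decomposition with its constant. -/

namespace MatrixWavelet

variable {n m : ℕ}

/-- The Gram determinant is a polynomial in `t` with value `1` at `t = 0`, so it has finitely many
roots. -/
theorem finite_setOf_matVol_smul_add_stdEmb (hmn : m ≤ n) (z : Matrix (Fin n) (Fin m) ℝ) :
    {t : ℝ | matVol (t • z + stdEmb n m) = 0}.Finite := by
  set P : Matrix (Fin n) (Fin m) (Polynomial ℝ) :=
    (Polynomial.X : Polynomial ℝ) • z.map Polynomial.C + (stdEmb n m).map Polynomial.C
  set Q : Polynomial ℝ := (Pᵀ * P).det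
  have hQ : ∀ t, Q.eval t = ((t • z + stdEmb n m)ᵀ * (t • z + stdEmb n m)).det := fun t => by
    have h1 : P.map (Polynomial.evalRingHom t) = t • z + stdEmb n m := by
      ext i j
      simp [P]
      exact mul_comm _ _
    rw [← Polynomial.coe_evalRingHom, RingHom.map_det, RingHom.mapMatrix_apply, Matrix.map_mul,
      Matrix.transpose_map, h1]
  have h0 : Q ≠ 0 := fun h => by
    have := hQ 0
    rw [h, zero_smul, zero_add, stdEmb_gram hmn] at this
    simp at this
  refine (Polynomial.finite_setOfPred_isRoot h0).subset fun t ht => ?_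
  change Q.eval t = 0
  rw [hQ]
  exact (Real.sqrt_eq_zero (gram_posSemidef _).det_nonneg).1 ht

/-- Almost every matrix has full rank. -/
theorem ae_matVol_ne_zero (hmn : m ≤ n) :
    ∀ᵐ z : Matrix (Fin n) (Fin m) ℝ, matVol z ≠ 0 := by
  have hc : Continuous fun p : ℝ × Matrix (Fin n) (Fin m) ℝ =>
      matVol (p.2 + p.1 • stdEmb n m) := continuous_matVol.comp (by fun_prop)
  have hms : MeasurableSet {p : ℝ × Matrix (Fin n) (Fin m) ℝ |
      matVol (p.2 + p.1 • stdEmb n m) ≠ 0} := (isOpen_ne_fun hc continuous_const).measurableSet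
  have h1 : ∀ z : Matrix (Fin n) (Fin m) ℝ, ∀ᵐ t : ℝ, matVol (z + t • stdEmb n m) ≠ 0 := by
    intro z
    have hfin : ((fun t : ℝ => t⁻¹) ⁻¹' {t : ℝ | matVol (t • z + stdEmb n m) = 0} ∪ {0}).Finite :=
      ((finite_setOf_matVol_smul_add_stdEmb hmn z).preimage inv_injective.injOn).union
        (Set.finite_singleton 0)
    refine (hfin.measure_zero volume : _) |> measure_mono_null fun t ht => ?_
    by_cases h0 : t = 0
    · exact Or.inr h0
    · refine Or.inl ?_
      have ht' : matVol (z + t • stdEmb n m) = 0 := not_not.1 ht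
      have h2 : z + t • stdEmb n m = (t⁻¹ • z + stdEmb n m) * (t • (1 : Matrix (Fin m) (Fin m) ℝ))ᵀ := by
        rw [Matrix.transpose_smul, Matrix.transpose_one, Matrix.mul_smul, Matrix.mul_one, smul_add,
          smul_smul, mul_inv_cancel₀ h0, one_smul]
      rw [h2, matVol_mul_transpose, Matrix.det_smul, Matrix.det_one, mul_one] at ht'
      exact (mul_eq_zero.1 ht').resolve_left (abs_ne_zero.2 (pow_ne_zero _ h0))
  -- Fubini over the lines parallel to `stdEmb`. A single good `t` suffices, because Lebesgue
  -- measure is translation invariant.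
  have h2 : ∀ᵐ t : ℝ, ∀ᵐ z : Matrix (Fin n) (Fin m) ℝ, matVol (z + t • stdEmb n m) ≠ 0 :=
    (Measure.ae_ae_comm hms).2 (Eventually.of_forall h1)
  obtain ⟨t, ht⟩ := h2.exists
  have h3 := measure_preimage_add_right (volume : Measure (Matrix (Fin n) (Fin m) ℝ))
    (t • stdEmb n m) {z | ¬ matVol z ≠ 0}
  rw [ae_iff, ← h3]
  exact ht

/-- The density against `dStar` of the function whose integral is the Siegel gamma function. -/
theorem lintegral_dStar_gaussian (m : ℕ) (α : ℝ) :
    ∫⁻ s, ENNReal.ofReal (Real.exp (-s.trace) * s.det ^ α) ∂(dStar m) =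
      ∫⁻ s in cone m, ENNReal.ofReal (Real.exp (-s.trace) * s.det ^ (α - ((m : ℝ) + 1) / 2))
        ∂(lebSym m) := by
  have hdet : Measurable fun s : Matrix (Fin m) (Fin m) ℝ => s.det :=
    (Continuous.matrix_det continuous_id).measurable
  have htr : Measurable fun s : Matrix (Fin m) (Fin m) ℝ => s.trace :=
    (Continuous.matrix_trace continuous_id).measurable
  have hf : Measurable fun s : Matrix (Fin m) (Fin m) ℝ =>
      ENNReal.ofReal (Real.exp (-s.trace) * s.det ^ α) :=
    ((Real.measurable_exp.comp htr.neg).mul (hdet.pow_const _)).ennreal_ofReal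
  rw [dStar, lintegral_withDensity_eq_lintegral_mul _ (measurable_det_rpow _) hf]
  refine setLIntegral_congr_fun measurableSet_cone fun s hs => ?_
  have hs' : 0 < s.det := Matrix.PosDef.det_pos hs
  simp only [Pi.mul_apply]
  rw [← ENNReal.ofReal_mul (by positivity), mul_left_comm, ← Real.rpow_add hs']
  congr 3
  ring

/-- No convergence is needed: both sides are `0` by convention if the integral diverges. -/
theorem siegelGamma_eq_toReal (m : ℕ) (α : ℝ) :
    siegelGamma m α =
      (∫⁻ s, ENNReal.ofReal (Real.exp (-s.trace) * s.det ^ α) ∂(dStar m)).toReal := by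
  have hdet : Measurable fun s : Matrix (Fin m) (Fin m) ℝ => s.det :=
    (Continuous.matrix_det continuous_id).measurable
  have htr : Measurable fun s : Matrix (Fin m) (Fin m) ℝ => s.trace :=
    (Continuous.matrix_trace continuous_id).measurable
  rw [lintegral_dStar_gaussian, siegelGamma, integral_eq_lintegral_of_nonneg_ae]
  · filter_upwards [ae_restrict_mem measurableSet_cone] with s hs
    have hs' : 0 < s.det := Matrix.PosDef.det_pos hs
    simp only [Pi.zero_apply]
    positivity
  · exact ((Real.measurable_exp.comp htr.neg).mul (hdet.pow_const _)).aestronglyMeasurable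

theorem lintegral_gramMeasure_gaussian (hmn : m ≤ n) :
    ∫⁻ s, ENNReal.ofReal (Real.exp (-s.trace) * s.det ^ ((n : ℝ) / 2)) ∂(gramMeasure n m) =
      ENNReal.ofReal (Real.pi ^ ((n : ℝ) * m / 2)) := by
  have hdet : Measurable fun s : Matrix (Fin m) (Fin m) ℝ => s.det :=
    (Continuous.matrix_det continuous_id).measurable
  have htr : Measurable fun s : Matrix (Fin m) (Fin m) ℝ => s.trace :=
    (Continuous.matrix_trace continuous_id).measurable
  have hf : Measurable fun s : Matrix (Fin m) (Fin m) ℝ =>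
      ENNReal.ofReal (Real.exp (-s.trace) * s.det ^ ((n : ℝ) / 2)) :=
    ((Real.measurable_exp.comp htr.neg).mul (hdet.pow_const _)).ennreal_ofReal
  have hfg : Measurable fun z : Matrix (Fin n) (Fin m) ℝ =>
      ENNReal.ofReal (Real.exp (-(zᵀ * z).trace) * (zᵀ * z).det ^ ((n : ℝ) / 2)) :=
    hf.comp measurable_gram
  rw [gramMeasure, lintegral_map hf measurable_gram, invVolume,
    lintegral_withDensity_eq_lintegral_mul _ measurable_invVolume_density hfg,
    ← lintegral_exp_neg_trace_gram]
  refine lintegral_congr_ae ((ae_matVol_ne_zero hmn).mono fun z hz => ?_)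
  have hd : 0 < (zᵀ * z).det := (gram_posDef_iff.2 hz).det_pos
  have hp : (zᵀ * z).det ^ ((n : ℝ) / 2) = matVol z ^ n := by
    rw [matVol, Real.sqrt_eq_rpow, ← Real.rpow_natCast, ← Real.rpow_mul hd.le]
    congr 1; ring
  simp only [Pi.mul_apply]
  have hv : 0 ≤ matVol z := matVol_nonneg z
  rw [hp, ← ENNReal.ofReal_mul (by positivity), mul_left_comm,
    inv_mul_cancel₀ (pow_ne_zero _ hz), mul_one]

/-- Polar decomposition: the image of `|z|_m^{-n} dz` under `z ↦ zᵀz` is a multiple of the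
invariant measure. -/
theorem gramMeasure_eq_smul_dStar (hm : m ≠ 0) (hmn : m ≤ n) :
    0 < stiefelMass n m / 2 ^ m ∧
      gramMeasure n m = ENNReal.ofReal (stiefelMass n m / 2 ^ m) • dStar m := by
  have hn : n ≠ 0 := by omega
  set E := invVolume m m {g | gᵀ * g ∈ testSet m} with hE
  have hE' : E = gramMeasure m m (testSet m) := by
    rw [gramMeasure, Measure.map_apply measurable_gram measurableSet_testSet]; rfl
  have hE0 : E ≠ 0 := hE' ▸ gramMeasure_testSet_pos le_rfl
  have hEt : E ≠ ⊤ := hE' ▸ (gramMeasure_testSet_lt_top hm).ne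
  set a := gramMeasure n m (testSet m)
  set b := dStar m (testSet m)
  have ha0 : a ≠ 0 := gramMeasure_testSet_pos hmn
  have hat : a ≠ ⊤ := (gramMeasure_testSet_lt_top hn).ne
  have hb0 : b ≠ 0 := dStar_testSet_pos
  have hbt : b ≠ ⊤ := dStar_testSet_lt_top.ne
  -- The comparison identity for both invariant measures has the same Haar integral on the right,
  -- and the common factor `E` is positive and finite, hence cancels.
  have hκ : gramMeasure n m = (a / b) • dStar m := by
    refine Measure.ext_of_lintegral _ fun f hf => ?_
    have h1 := lintegral_mul_invVolume_testSet hm gramMeasure_isCongrInvariant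
      (ae_gramMeasure_posDef (n := n) (m := m) hn) hf
    have h2 := lintegral_mul_invVolume_testSet hm dStar_isCongrInvariant
      (ae_dStar_posDef (m := m)) hf
    rw [lintegral_smul_measure, smul_eq_mul]
    rw [← ENNReal.mul_left_inj hE0 hEt, h1, mul_assoc, h2, ← mul_assoc,
      ENNReal.div_mul_cancel hb0 hbt]
  -- Testing on `exp(-tr s) det(s)^{n/2}` gives `(a / b) Γ_m(n/2) = π^{nm/2}`, which also shows
  -- `Γ_m(n/2) ≠ 0`.
  set G := ∫⁻ s, ENNReal.ofReal (Real.exp (-s.trace) * s.det ^ ((n : ℝ) / 2)) ∂(dStar m) with hG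
  have h3 := lintegral_gramMeasure_gaussian (n := n) (m := m) hmn
  rw [hκ, lintegral_smul_measure, smul_eq_mul, ← hG] at h3
  have h4 := congrArg ENNReal.toReal h3
  have hpi : 0 < Real.pi ^ ((n : ℝ) * m / 2) := Real.rpow_pos_of_pos Real.pi_pos _
  rw [ENNReal.toReal_mul, ENNReal.toReal_ofReal hpi.le, hG, ← siegelGamma_eq_toReal] at h4
  have hκt : a / b ≠ ⊤ := ENNReal.div_ne_top hat hb0
  have hκ0 : a / b ≠ 0 := ENNReal.div_ne_zero.2 ⟨ha0, hbt⟩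
  have hΓ : siegelGamma m ((n : ℝ) / 2) ≠ 0 := fun h => by
    rw [h, mul_zero] at h4
    exact hpi.ne h4
  have h5 : stiefelMass n m / 2 ^ m = (a / b).toReal := by
    rw [stiefelMass, ← h4]
    field_simp
  rw [h5, ENNReal.ofReal_toReal hκt]
  exact ⟨ENNReal.toReal_pos hκ0 hκt, hκ⟩

end MatrixWavelet

/-! ### Complex measures as unimodular densities against their variation. -/

namespace MatrixWavelet

section PolarDecomposition

open scoped MeasureTheory

variable {X : Type*} [MeasurableSpace X]

instance complexMeasure_variation_finite (ν : ComplexMeasure X) :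
    IsFiniteMeasure ν.variation := by
  have h : ν.variation ≤ ν.re.totalVariation + ν.im.totalVariation := by
    refine VectorMeasure.variation_le_of_forall_enorm_le fun s _ => ?_
    have h1 : ‖ν s‖ₑ ≤ ‖ν.re s‖ₑ + ‖ν.im s‖ₑ := by
      have h2 : ν s = ((ν s).re : ℂ) + ((ν s).im : ℂ) * Complex.I := (Complex.re_add_im _).symm
      calc ‖ν s‖ₑ = ‖((ν s).re : ℂ) + ((ν s).im : ℂ) * Complex.I‖ₑ := by rw [← h2]
        _ ≤ ‖((ν s).re : ℂ)‖ₑ + ‖((ν s).im : ℂ) * Complex.I‖ₑ := enorm_add_le _ _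
        _ = ‖ν.re s‖ₑ + ‖ν.im s‖ₑ := by
          rw [enorm_mul, ← ofReal_norm, ← ofReal_norm, ← ofReal_norm, ← ofReal_norm,
            ← ofReal_norm, Complex.norm_real, Complex.norm_real, Complex.norm_I,
            ENNReal.ofReal_one, mul_one]
          rfl
    rw [Measure.add_apply, SignedMeasure.totalVariation_eq_variation,
      SignedMeasure.totalVariation_eq_variation]
    exact h1.trans <| add_le_add (VectorMeasure.enorm_measure_le_variation _ _)
      (VectorMeasure.enorm_measure_le_variation _ _)
  exact isFiniteMeasure_of_le _ h

theorem exists_eq_withDensity_variation (ν : ComplexMeasure X) :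
    ∃ h : X → ℂ, Integrable h ν.variation ∧
      ∀ s, MeasurableSet s → ν s = ∫ x in s, h x ∂ν.variation := by
  set μ := ν.variation with hμ
  have hzero : ∀ s, MeasurableSet s → μ.toENNRealVectorMeasure s = 0 → ν s = 0 := by
    intro s hs h0
    rw [Measure.toENNRealVectorMeasure_apply_measurable hs] at h0
    have := VectorMeasure.enorm_measure_le_variation ν s
    rw [← hμ, h0] at this
    simpa using this
  have hre : ν.re ≪ᵥ μ.toENNRealVectorMeasure :=
    VectorMeasure.AbsolutelyContinuous.mk fun s hs h0 =>
      congrArg Complex.re (hzero s hs h0)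
  have him : ν.im ≪ᵥ μ.toENNRealVectorMeasure :=
    VectorMeasure.AbsolutelyContinuous.mk fun s hs h0 =>
      congrArg Complex.im (hzero s hs h0)
  have h1 := SignedMeasure.withDensityᵥ_rnDeriv_eq _ _ hre
  have h2 := SignedMeasure.withDensityᵥ_rnDeriv_eq _ _ him
  have hint := ComplexMeasure.integrable_rnDeriv ν μ
  refine ⟨ν.rnDeriv μ, hint, fun s hs => ?_⟩
  have e1 : (ν s).re = ∫ x in s, ν.re.rnDeriv μ x ∂μ := by
    rw [← withDensityᵥ_apply (SignedMeasure.integrable_rnDeriv _ _) hs, h1]; rfl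
  have e2 : (ν s).im = ∫ x in s, ν.im.rnDeriv μ x ∂μ := by
    rw [← withDensityᵥ_apply (SignedMeasure.integrable_rnDeriv _ _) hs, h2]; rfl
  apply Complex.ext
  · rw [e1, ← RCLike.re_eq_complex_re, ← integral_re hint.integrableOn]; rfl
  · rw [e2, ← RCLike.im_eq_complex_im, ← integral_im hint.integrableOn]; rfl

/-- If `ν = h |ν|`, taking variations gives `|ν| = |h| |ν|`, so `|h| = 1` almost everywhere.
Changing `h` on a null set makes this hold everywhere. -/
theorem exists_unimodular_density (ν : ComplexMeasure X) :
    ∃ k : X → ℂ, Measurable k ∧ (∀ x, ‖k x‖ = 1) ∧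
      ∀ s, MeasurableSet s → ν s = ∫ x in s, k x ∂ν.variation := by
  classical
  obtain ⟨h, hint, hh⟩ := exists_eq_withDensity_variation ν
  have h1 : ν = ν.variation.withDensityᵥ h := by
    ext s hs
    rw [withDensityᵥ_apply hint hs, hh s hs]
  have h2 : ν.variation = ν.variation.withDensity fun x => ‖h x‖ₑ := by
    conv_lhs => rw [h1, Measure.variation_withDensityᵥ hint]
  have h3 : (fun x => ‖h x‖ₑ) =ᵐ[ν.variation] fun _ => 1 := by
    rw [← withDensity_eq_iff_of_sigmaFinite hint.aestronglyMeasurable.enorm aemeasurable_const,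
      ← h2]
    exact withDensity_one.symm
  obtain ⟨g, hgm, hg⟩ := hint.aestronglyMeasurable
  have hgm' := hgm.measurable
  refine ⟨fun x => if ‖g x‖ = 1 then g x else 1, ?_, fun x => ?_, fun s hs => ?_⟩
  · exact Measurable.ite (hgm'.norm (measurableSet_singleton 1)) hgm' measurable_const
  · dsimp only
    split_ifs with hx
    · exact hx
    · exact norm_one
  · rw [hh s hs]
    refine integral_congr_ae (ae_restrict_of_ae ?_)
    filter_upwards [h3, hg] with x hx1 hx2
    have : ‖g x‖ = 1 := by
      rw [← hx2, ← toReal_enorm, hx1, ENNReal.toReal_one]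
    rw [if_pos this, hx2]

/-- Both sides agree on indicators and are continuous in `L¹`. As `|k| = 1`, multiplication by `k`
preserves non-integrability as well, so `g` may be arbitrary. -/
theorem integral_complexMeasure_eq {ν : ComplexMeasure X} {k : X → ℂ} (hk : Measurable k)
    (hk1 : ∀ x, ‖k x‖ = 1) (hν : ∀ s, MeasurableSet s → ν s = ∫ x in s, k x ∂ν.variation)
    (g : X → ℂ) :
    ν.integral g (ContinuousLinearMap.mul ℝ ℂ) = ∫ x, g x * k x ∂ν.variation := by
  have hbd : ∀ {g : X → ℂ}, Integrable g ν.variation →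
      Integrable (fun x => g x * k x) ν.variation := fun hg =>
    hg.mul_bdd hk.aestronglyMeasurable (Eventually.of_forall fun x => (hk1 x).le)
  by_cases hg : Integrable g ν.variation
  · refine Integrable.induction
      (fun g => ν.integral g (ContinuousLinearMap.mul ℝ ℂ) = ∫ x, g x * k x ∂ν.variation)
      (fun c s hs hμs => ?_) (fun f g _ hf hg hf' hg' => ?_) ?_ (fun f g hfg hf hf' => ?_) hg
    · rw [VectorMeasure.integral_eq_setToFun, setToFun_indicator_const _ hs hμs.ne]
      have : ∀ x, s.indicator (fun _ => c) x * k x = s.indicator (fun x => c * k x) x := fun x => by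
        by_cases hx : x ∈ s <;> simp [hx]
      simp only [this]
      rw [integral_indicator hs, integral_const_mul, ← hν s hs]
      rfl
    · rw [VectorMeasure.integral_add hf hg, hf', hg', ← integral_add (hbd hf) (hbd hg)]
      simp only [Pi.add_apply, add_mul]
    · refine isClosed_eq VectorMeasure.continuous_integral ?_
      have hL : ∀ f : X →₁[ν.variation] ℂ, ∫ x, f x * k x ∂ν.variation =
          ∫ x, (hbd (L1.integrable_coeFn f)).toL1 _ x ∂ν.variation := fun f =>
        integral_congr_ae (Integrable.coeFn_toL1 _).symm
      simp only [hL]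
      refine continuous_integral.comp (LipschitzWith.continuous (K := 1) fun f g => ?_)
      rw [ENNReal.coe_one, one_mul, Integrable.edist_toL1_toL1, L1.edist_def]
      refine lintegral_mono fun x => ?_
      rw [edist_eq_enorm_sub, edist_eq_enorm_sub, ← sub_mul, enorm_mul]
      have : ‖k x‖ₑ = 1 := by rw [← ofReal_norm, hk1, ENNReal.ofReal_one]
      rw [this, mul_one]
    · rw [← VectorMeasure.integral_congr_ae hfg, hf']
      exact integral_congr_ae (hfg.mono fun x hx => by dsimp only; rw [hx])
  · rw [VectorMeasure.integral_undef hg, integral_undef]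
    intro h
    refine hg ?_
    have := h.mul_bdd (c := 1) hk.inv.aestronglyMeasurable
      (Eventually.of_forall fun x => by simp [hk1 x])
    refine this.congr (Eventually.of_forall fun x => ?_)
    have hx : k x ≠ 0 := fun h0 => by simpa [h0] using hk1 x
    dsimp only
    rw [mul_assoc, Pi.inv_apply, mul_inv_cancel₀ hx, mul_one]

end PolarDecomposition

end MatrixWavelet

/-! ### Averages of translates as Fourier multipliers on `L²`. -/

namespace MatrixWavelet

section Averages

open scoped FourierTransform SchwartzMap

variable {X Ω : Type*} [MeasurableSpace X] [MeasurableSpace Ω]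

/-- Cauchy–Schwarz against the constant `1` on the finite measure space `Q`. -/
theorem memLp_two_integral_prod {μ : Measure X} [SFinite μ] {Q : Measure Ω} [IsFiniteMeasure Q]
    {H : X × Ω → ℂ} (hH : MemLp H 2 (μ.prod Q)) :
    (∀ᵐ x ∂μ, Integrable (fun ω => H (x, ω)) Q) ∧ MemLp (fun x => ∫ ω, H (x, ω) ∂Q) 2 μ := by
  have h2 : ∫⁻ p, ‖H p‖ₑ ^ (2 : ℝ) ∂(μ.prod Q) < ⊤ := by
    have := (eLpNorm_lt_top_iff_lintegral_rpow_enorm_lt_top two_ne_zero ENNReal.ofNat_ne_top).1 hH.2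
    simpa using this
  have hm : AEMeasurable (fun p => ‖H p‖ₑ ^ (2 : ℝ)) (μ.prod Q) :=
    hH.aestronglyMeasurable.enorm.pow_const _
  rw [lintegral_prod _ hm] at h2
  have hsec := hH.aestronglyMeasurable.prodMk_left
  have hCS : ∀ᵐ x ∂μ, (∫⁻ ω, ‖H (x, ω)‖ₑ ∂Q) ^ (2 : ℝ) ≤
      Q Set.univ * ∫⁻ ω, ‖H (x, ω)‖ₑ ^ (2 : ℝ) ∂Q := by
    filter_upwards [hsec] with x hx
    have h := ENNReal.lintegral_mul_le_Lp_mul_Lq Q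
      (Real.HolderConjugate.two_two) (aemeasurable_const (b := (1 : ENNReal))) hx.enorm
    simp only [Pi.mul_apply, one_mul, ENNReal.one_rpow, lintegral_const] at h
    calc (∫⁻ ω, ‖H (x, ω)‖ₑ ∂Q) ^ (2 : ℝ) ≤ _ := ENNReal.rpow_le_rpow h zero_le_two
      _ = _ := by
        rw [ENNReal.mul_rpow_of_nonneg _ _ zero_le_two, ← ENNReal.rpow_mul, ← ENNReal.rpow_mul]
        norm_num
  refine ⟨?_, hH.aestronglyMeasurable.integral_prod_right', ?_⟩
  · filter_upwards [hsec, hCS, ae_lt_top' hm.lintegral_prod_right' h2.ne] with x hx1 hx2 hx3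
    refine ⟨hx1, ?_⟩
    have : (∫⁻ ω, ‖H (x, ω)‖ₑ ∂Q) ^ (2 : ℝ) < ⊤ :=
      hx2.trans_lt (ENNReal.mul_lt_top (measure_lt_top _ _) hx3)
    exact (ENNReal.rpow_lt_top_iff_of_pos two_pos).1 this
  · rw [eLpNorm_lt_top_iff_lintegral_rpow_enorm_lt_top two_ne_zero ENNReal.ofNat_ne_top]
    simp only [ENNReal.toReal_ofNat]
    calc ∫⁻ x, ‖∫ ω, H (x, ω) ∂Q‖ₑ ^ (2 : ℝ) ∂μ
        ≤ ∫⁻ x, Q Set.univ * ∫⁻ ω, ‖H (x, ω)‖ₑ ^ (2 : ℝ) ∂Q ∂μ := by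
          refine lintegral_mono_ae (hCS.mono fun x hx => le_trans ?_ hx)
          exact ENNReal.rpow_le_rpow (enorm_integral_le_lintegral_enorm _) zero_le_two
      _ = Q Set.univ * ∫⁻ x, ∫⁻ ω, ‖H (x, ω)‖ₑ ^ (2 : ℝ) ∂Q ∂μ :=
          lintegral_const_mul' _ _ (measure_ne_top _ _)
      _ < ⊤ := ENNReal.mul_lt_top (measure_lt_top _ _) h2

variable {V : Type*} [NormedAddCommGroup V] [InnerProductSpace ℝ V]

/-- The Fourier multiplier of the averaging operator `f ↦ ∫ f(· - T ω) k ω dQ(ω)`. -/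
noncomputable def averageSymbol (Q : Measure Ω) (T : Ω → V) (k : Ω → ℂ) (ξ : V) : ℂ :=
  ∫ ω, (𝐞 (-(inner ℝ (T ω) ξ)) : ℂ) * k ω ∂Q

theorem norm_averageSymbol_le (Q : Measure Ω) [IsFiniteMeasure Q] (T : Ω → V)
    {k : Ω → ℂ} (hk1 : ∀ ω, ‖k ω‖ ≤ 1) (ξ : V) : ‖averageSymbol Q T k ξ‖ ≤ Q.real Set.univ := by
  refine (norm_integral_le_of_norm_le_const (C := 1) (Eventually.of_forall fun ω => ?_)).trans_eq
    (one_mul _)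
  rw [norm_mul, Circle.norm_coe, one_mul]
  exact hk1 ω

variable [FiniteDimensional ℝ V] [MeasurableSpace V] [BorelSpace V]

theorem measurePreserving_sub_prod {T : Ω → V} (hT : Measurable T) (Q : Measure Ω)
    [IsFiniteMeasure Q] :
    MeasurePreserving (fun p : V × Ω => (p.1 - T p.2, p.2))
      ((volume : Measure V).prod Q) ((volume : Measure V).prod Q) := by
  have h1 : MeasurePreserving (fun p : Ω × V => (p.1, p.2 - T p.1))
      (Q.prod (volume : Measure V)) (Q.prod (volume : Measure V)) :=
    (MeasurePreserving.id Q).skew_product (g := fun ω x => x - T ω)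
      (measurable_snd.sub (hT.comp measurable_fst))
      (Eventually.of_forall fun ω => (measurePreserving_sub_right volume (T ω)).map_eq)
  exact (Measure.measurePreserving_swap.comp h1).comp Measure.measurePreserving_swap

theorem memLp_translates {T : Ω → V} (hT : Measurable T) (Q : Measure Ω) [IsFiniteMeasure Q]
    {k : Ω → ℂ} (hk : Measurable k) (hk1 : ∀ ω, ‖k ω‖ ≤ 1) {f : V → ℂ} (hf : MemLp f 2 volume) :
    MemLp (fun p : V × Ω => f (p.1 - T p.2) * k p.2) 2 ((volume : Measure V).prod Q) := by
  have h1 : MemLp (fun p : V × Ω => f (p.1 - T p.2)) 2 ((volume : Measure V).prod Q) :=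
    (hf.comp_fst Q).comp_measurePreserving (measurePreserving_sub_prod hT Q)
  refine MemLp.of_le h1 (h1.aestronglyMeasurable.mul
    (hk.comp measurable_snd).aestronglyMeasurable) (Eventually.of_forall fun p => ?_)
  rw [norm_mul]
  exact mul_le_of_le_one_right (norm_nonneg _) (hk1 _)

/-- The translation is moved onto `φ`, where it becomes a modulation of a pointwise Fourier
integral; Plancherel then involves only the `L²` transform of the fixed class of `f`. -/
theorem inner_translate_eq (φ : 𝓢(V, ℂ)) {f : V → ℂ} (hf : MemLp f 2 volume) (v : V) :
    ∫ x, f (x - v) * (starRingEnd ℂ) (φ x) =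
      ∫ ξ, (𝐞 (-(inner ℝ v ξ)) : ℂ) * ((𝓕 (hf.toLp f) : Lp (α := V) ℂ 2 volume) ξ *
        (starRingEnd ℂ) (𝓕 φ ξ)) := by
  set τ : 𝓢(V, ℂ) := SchwartzMap.compSubConstCLM ℂ (-v) φ with hτ
  have hτx : ∀ x, τ x = φ (x + v) := fun x => by
    rw [hτ, SchwartzMap.compSubConstCLM_apply, sub_neg_eq_add]
  have h1 : ∫ x, f (x - v) * (starRingEnd ℂ) (φ x) = inner ℂ (τ.toLp 2) (hf.toLp f) := by
    rw [L2.inner_def, ← integral_add_right_eq_self _ v]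
    refine integral_congr_ae ?_
    filter_upwards [τ.coeFn_toLp 2, hf.coeFn_toLp] with x hx1 hx2
    rw [hx1, hx2, hτx, add_sub_cancel_right, RCLike.inner_apply]
  rw [h1, ← Lp.inner_fourier_eq, SchwartzMap.toLp_fourier_eq, L2.inner_def]
  refine integral_congr_ae ?_
  filter_upwards [(𝓕 τ).coeFn_toLp 2] with ξ hξ
  have h2 : (𝓕 τ) ξ = (𝐞 (inner ℝ v ξ) : Circle) • (𝓕 φ) ξ := by
    have h3 : (τ : V → ℂ) = (φ : V → ℂ) ∘ fun x => x + v := funext hτx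
    have h4 := congrFun (VectorFourier.fourierIntegral_comp_add_right Real.fourierChar
      (volume : Measure V) (innerₗ V) (φ : V → ℂ) v) ξ
    rw [SchwartzMap.fourier_coe, SchwartzMap.fourier_coe, h3]
    exact h4
  rw [hξ, h2, RCLike.inner_apply, Circle.smul_def, smul_eq_mul, map_mul, AddChar.map_neg_eq_inv,
    Circle.coe_inv_eq_conj]
  ring

theorem measurable_averageKernel {T : Ω → V} (hT : Measurable T) {k : Ω → ℂ} (hk : Measurable k) :
    Measurable fun p : V × Ω => (𝐞 (-(inner ℝ (T p.2) p.1)) : ℂ) * k p.2 := by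
  refine Measurable.mul ?_ (hk.comp measurable_snd)
  exact (continuous_subtype_val.comp Real.continuous_fourierChar).measurable.comp
    ((hT.comp measurable_snd).inner measurable_fst).neg

theorem measurable_averageSymbol (Q : Measure Ω) [SFinite Q] {T : Ω → V} (hT : Measurable T)
    {k : Ω → ℂ} (hk : Measurable k) : Measurable (averageSymbol Q T k) :=
  (measurable_averageKernel hT hk).stronglyMeasurable.integral_prod_right'.measurable

theorem integral_average_mul_conj (φ : 𝓢(V, ℂ)) {f : V → ℂ} (hf : MemLp f 2 volume)
    {T : Ω → V} (hT : Measurable T) (Q : Measure Ω) [IsFiniteMeasure Q]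
    {k : Ω → ℂ} (hk : Measurable k) (hk1 : ∀ ω, ‖k ω‖ ≤ 1) :
    ∫ x, (∫ ω, f (x - T ω) * k ω ∂Q) * (starRingEnd ℂ) (φ x) =
      ∫ ξ, averageSymbol Q T k ξ * (𝓕 (hf.toLp f) : Lp (α := V) ℂ 2 volume) ξ *
        (starRingEnd ℂ) (𝓕 φ ξ) := by
  have hφ : MemLp (fun x => (starRingEnd ℂ) (φ x)) 2 (volume : Measure V) := by exact (φ.memLp 2 volume).star
  have hφF : MemLp (fun x => (starRingEnd ℂ) (𝓕 φ x)) 2 (volume : Measure V) :=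
    by exact ((𝓕 φ).memLp 2 volume).star
  have hint1 : Integrable (fun p : V × Ω => f (p.1 - T p.2) * k p.2 * (starRingEnd ℂ) (φ p.1))
      ((volume : Measure V).prod Q) :=
    (memLp_translates hT Q hk hk1 hf).integrable_mul (hφ.comp_fst Q)
  have hint2 : Integrable (fun p : V × Ω => (𝐞 (-(inner ℝ (T p.2) p.1)) : ℂ) * k p.2 *
      ((𝓕 (hf.toLp f) : Lp (α := V) ℂ 2 volume) p.1 * (starRingEnd ℂ) (𝓕 φ p.1)))
      ((volume : Measure V).prod Q) := by
    have h0 : Integrable (fun ξ => (𝓕 (hf.toLp f) : Lp (α := V) ℂ 2 volume) ξ *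
      (starRingEnd ℂ) (𝓕 φ ξ)) (volume : Measure V) := (Lp.memLp _).integrable_mul hφF
    refine (h0.comp_fst Q).bdd_mul (c := 1)
      (measurable_averageKernel hT hk).aestronglyMeasurable (Eventually.of_forall fun p => ?_)
    rw [norm_mul, Circle.norm_coe, one_mul]
    exact hk1 _
  calc ∫ x, (∫ ω, f (x - T ω) * k ω ∂Q) * (starRingEnd ℂ) (φ x)
      = ∫ x, ∫ ω, f (x - T ω) * k ω * (starRingEnd ℂ) (φ x) ∂Q := by
        simp_rw [integral_mul_const]
    _ = ∫ ω, (∫ x, f (x - T ω) * k ω * (starRingEnd ℂ) (φ x)) ∂Q := integral_integral_swap hint1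
    _ = ∫ ω, (∫ x, f (x - T ω) * (starRingEnd ℂ) (φ x)) * k ω ∂Q := by
        congr 1; ext ω
        rw [← integral_mul_const]
        congr 1; ext x; ring
    _ = ∫ ω, (∫ ξ, (𝐞 (-(inner ℝ (T ω) ξ)) : ℂ) * k ω *
          ((𝓕 (hf.toLp f) : Lp (α := V) ℂ 2 volume) ξ * (starRingEnd ℂ) (𝓕 φ ξ))) ∂Q := by
        congr 1; ext ω
        rw [inner_translate_eq φ hf, ← integral_mul_const]
        congr 1; ext x; ring
    _ = ∫ ξ, (∫ ω, (𝐞 (-(inner ℝ (T ω) ξ)) : ℂ) * k ω *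
          ((𝓕 (hf.toLp f) : Lp (α := V) ℂ 2 volume) ξ * (starRingEnd ℂ) (𝓕 φ ξ)) ∂Q) :=
        (integral_integral_swap hint2).symm
    _ = _ := by
        simp_rw [integral_mul_const, averageSymbol, mul_assoc]

/-- Averages of translates act on `L²` as Fourier multipliers. -/
theorem fourier_average_ae_eq {f : V → ℂ} (hf : MemLp f 2 volume)
    {T : Ω → V} (hT : Measurable T) (Q : Measure Ω) [IsFiniteMeasure Q]
    {k : Ω → ℂ} (hk : Measurable k) (hk1 : ∀ ω, ‖k ω‖ ≤ 1)
    (hg : MemLp (fun x => ∫ ω, f (x - T ω) * k ω ∂Q) 2 (volume : Measure V)) :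
    (𝓕 (hg.toLp _) : Lp (α := V) ℂ 2 volume) =ᵐ[volume]
      fun ξ => averageSymbol Q T k ξ * (𝓕 (hf.toLp f) : Lp (α := V) ℂ 2 volume) ξ := by
  have hM : MemLp (fun ξ => averageSymbol Q T k ξ *
      (𝓕 (hf.toLp f) : Lp (α := V) ℂ 2 volume) ξ) 2 volume := by
    refine MemLp.of_le_mul (c := Q.real Set.univ) (Lp.memLp (𝓕 (hf.toLp f)))
      ((measurable_averageSymbol Q hT hk).aestronglyMeasurable.mul
        (Lp.aestronglyMeasurable _)) (Eventually.of_forall fun ξ => ?_)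
    rw [norm_mul]
    exact mul_le_mul_of_nonneg_right (norm_averageSymbol_le Q T hk1 ξ) (norm_nonneg _)
  suffices h : (𝓕 (hg.toLp _) : Lp (α := V) ℂ 2 volume) = hM.toLp _ by
    rw [h]; exact hM.coeFn_toLp
  have hdense : DenseRange (SchwartzMap.toLpCLM ℂ ℂ 2 (volume : Measure V)) :=
    SchwartzMap.denseRange_toLpCLM (by simp)
  refine hdense.eq_of_inner_right ℂ fun ψ => ?_
  -- Writing the dense test functions as transforms lets Plancherel carry the pairing back to the
  -- space side.
  obtain ⟨φ, rfl⟩ : ∃ φ : 𝓢(V, ℂ), 𝓕 φ = ψ := ⟨𝓕⁻ ψ, FourierTransform.fourier_fourierInv_eq ψ⟩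
  change inner ℂ ((𝓕 φ).toLp 2) _ = inner ℂ ((𝓕 φ).toLp 2) _
  have h1 : inner ℂ ((𝓕 φ).toLp 2) (hM.toLp _) = ∫ ξ, averageSymbol Q T k ξ *
      (𝓕 (hf.toLp f) : Lp (α := V) ℂ 2 volume) ξ * (starRingEnd ℂ) (𝓕 φ ξ) := by
    rw [L2.inner_def]
    refine integral_congr_ae ?_
    filter_upwards [(𝓕 φ).coeFn_toLp 2, hM.coeFn_toLp] with x hx1 hx2
    rw [hx1, hx2, RCLike.inner_apply]
  rw [h1, ← SchwartzMap.toLp_fourier_eq, Lp.inner_fourier_eq,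
    ← integral_average_mul_conj φ hf hT Q hk hk1, L2.inner_def]
  refine integral_congr_ae ?_
  filter_upwards [φ.coeFn_toLp 2, hg.coeFn_toLp] with x hx1 hx2
  rw [hx1, hx2, RCLike.inner_apply]

theorem eLpNorm_average_sub {f : V → ℂ} (hf : MemLp f 2 volume)
    {T : Ω → V} (hT : Measurable T) (Q : Measure Ω) [IsFiniteMeasure Q]
    {k : Ω → ℂ} (hk : Measurable k) (hk1 : ∀ ω, ‖k ω‖ ≤ 1) (c : ℂ) :
    eLpNorm (fun x => (∫ ω, f (x - T ω) * k ω ∂Q) - c * f x) 2 (volume : Measure V) =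
      eLpNorm (fun ξ => (averageSymbol Q T k ξ - c) *
        (𝓕 (hf.toLp f) : Lp (α := V) ℂ 2 volume) ξ) 2 volume := by
  have hg := (memLp_two_integral_prod (memLp_translates hT Q hk hk1 hf)).2
  have hF := fourier_average_ae_eq hf hT Q hk hk1 hg
  set G : Lp (α := V) ℂ 2 volume := hg.toLp _ + (-c) • hf.toLp f with hG
  have h1 : (fun x => (∫ ω, f (x - T ω) * k ω ∂Q) - c * f x) =ᵐ[volume] G := by
    filter_upwards [Lp.coeFn_add (hg.toLp _) ((-c) • hf.toLp f), Lp.coeFn_smul (-c) (hf.toLp f),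
      hg.coeFn_toLp, hf.coeFn_toLp] with x h1 h2 h3 h4
    rw [h1, Pi.add_apply, h2, Pi.smul_apply, h3, h4, smul_eq_mul, neg_mul, sub_eq_add_neg]
  have h2 : (fun ξ => (averageSymbol Q T k ξ - c) *
      (𝓕 (hf.toLp f) : Lp (α := V) ℂ 2 volume) ξ) =ᵐ[volume] (𝓕 G : Lp (α := V) ℂ 2 volume) := by
    have h3 : (𝓕 G : Lp (α := V) ℂ 2 volume) = 𝓕 (hg.toLp _) + (-c) • 𝓕 (hf.toLp f) := by
      rw [hG, FourierTransform.fourier_add, FourierTransform.fourier_smul]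
    rw [h3]
    filter_upwards [Lp.coeFn_add (𝓕 (hg.toLp _)) ((-c) • 𝓕 (hf.toLp f)),
      Lp.coeFn_smul (-c) (𝓕 (hf.toLp f)), hF] with x h1 h2 h3
    rw [h1, Pi.add_apply, h2, Pi.smul_apply, h3, smul_eq_mul, neg_mul, sub_mul, sub_eq_add_neg]
  rw [eLpNorm_congr_ae h1, eLpNorm_congr_ae h2, ← Lp.enorm_def, ← Lp.enorm_def, ← ofReal_norm,
    ← ofReal_norm, Lp.norm_fourier_eq]

end Averages
end MatrixWavelet

/-! ### The truncated constant as an integral over the cone. -/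

namespace MatrixWavelet

section Constant

variable {n m : ℕ}

theorem posSemidef_sub_smul_one_iff {s : Matrix (Fin m) (Fin m) ℝ} (hs : s.IsHermitian) {δ : ℝ} :
    (s - δ • (1 : Matrix (Fin m) (Fin m) ℝ)).PosSemidef ↔ ∀ i, δ ≤ hs.eigenvalues i := by
  set U := (hs.eigenvectorUnitary : Matrix (Fin m) (Fin m) ℝ) with hU
  have h1 : s = U * Matrix.diagonal hs.eigenvalues * star U := by
    have h := hs.spectral_theorem
    rw [Unitary.conjStarAlgAut_apply] at h
    exact h
  have h2 : s - δ • (1 : Matrix (Fin m) (Fin m) ℝ) =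
      U * Matrix.diagonal (fun i => hs.eigenvalues i - δ) * star U := by
    have h3 : Matrix.diagonal (fun i => hs.eigenvalues i - δ) =
        Matrix.diagonal hs.eigenvalues - δ • (1 : Matrix (Fin m) (Fin m) ℝ) := by
      ext i j
      by_cases h : i = j
      · subst h; simp
      · simp [h]
    rw [h3, mul_sub, sub_mul, ← h1, mul_smul_comm, smul_mul_assoc, mul_one,
      show U * star U = 1 from Unitary.mul_star_self_of_mem hs.eigenvectorUnitary.2]
  have hu : IsUnit U := Unitary.isUnit_coe
  rw [h2, Matrix.IsUnit.posSemidef_star_right_conjugate_iff hu, Matrix.posSemidef_diagonal_iff]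
  simp

theorem pow_le_det_of_posSemidef_sub {s : Matrix (Fin m) (Fin m) ℝ} (hs : s.IsHermitian) {δ : ℝ}
    (hδ : 0 ≤ δ) (h : (s - δ • (1 : Matrix (Fin m) (Fin m) ℝ)).PosSemidef) : δ ^ m ≤ s.det := by
  rw [hs.det_eq_prod_eigenvalues]
  have h1 := (posSemidef_sub_smul_one_iff hs).1 h
  calc δ ^ m = ∏ _i : Fin m, δ := by simp
    _ ≤ ∏ i, hs.eigenvalues i := Finset.prod_le_prod (fun _ _ => hδ) fun i _ => h1 i

theorem exists_pos_posSemidef_sub {s : Matrix (Fin m) (Fin m) ℝ} (hs : s.PosDef) :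
    ∃ δ : ℝ, 0 < δ ∧ (s - δ • (1 : Matrix (Fin m) (Fin m) ℝ)).PosSemidef := by
  rcases isEmpty_or_nonempty (Fin m) with h | h
  · exact ⟨1, one_pos, (posSemidef_sub_smul_one_iff hs.isHermitian).2 fun i => h.elim i⟩
  · obtain ⟨i, hi⟩ := Finite.exists_min hs.isHermitian.eigenvalues
    exact ⟨_, hs.eigenvalues_pos i, (posSemidef_sub_smul_one_iff hs.isHermitian).2 hi⟩

theorem dStar_coneInterval_lt_top {ε : ℝ} (hε : 0 < ε) (ρ : ℝ) :
    dStar m (coneInterval (ε • (1 : Matrix (Fin m) (Fin m) ℝ)) (ρ • 1)) < ⊤ := by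
  refine dStar_lt_top_of_bounds (R := ρ * m) (δ := ε ^ m) (pow_pos hε m) fun s hs hp => ⟨?_, ?_⟩
  · have h := hs.2.posSemidef.trace_nonneg
    rw [Matrix.trace_sub, Matrix.trace_smul, Matrix.trace_one, Fintype.card_fin, smul_eq_mul] at h
    linarith
  · exact pow_le_det_of_posSemidef_sub hp.isHermitian hε.le hs.1.posSemidef

theorem tendsto_smul_coneNhdsZero {r : Matrix (Fin m) (Fin m) ℝ} (hr : r.PosDef) :
    Tendsto (fun ε : ℝ => ε • r) (𝓝[>] 0) (coneNhdsZero m) := by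
  refine tendsto_nhdsWithin_iff.2 ⟨?_, ?_⟩
  · have : Continuous fun ε : ℝ => ε • r := by fun_prop
    have h := this.tendsto 0
    rw [zero_smul] at h
    exact h.mono_left nhdsWithin_le_nhds
  · filter_upwards [self_mem_nhdsWithin] with ε hε
    exact hr.smul hε

theorem tendsto_smul_coneAtTop {r : Matrix (Fin m) (Fin m) ℝ} (hr : r.PosDef) :
    Tendsto (fun ρ : ℝ => ρ • r) atTop (coneAtTop m) := by
  obtain ⟨δ, hδ, h⟩ := exists_pos_posSemidef_sub hr
  refine tendsto_iInf.2 fun R => tendsto_principal.2 ?_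
  filter_upwards [eventually_gt_atTop 0, eventually_gt_atTop (R / δ)] with ρ h0 h1
  refine ⟨hr.smul h0, ?_⟩
  -- With `r ≥ δI`, the first summand is positive definite once `ρ > R/δ`.
  have h2 : ρ • r - R • (1 : Matrix (Fin m) (Fin m) ℝ) =
      (ρ * δ - R) • (1 : Matrix (Fin m) (Fin m) ℝ) + ρ • (r - δ • 1) := by
    rw [smul_sub, smul_smul, sub_smul]; abel
  rw [h2]
  have h3 : 0 < ρ * δ - R := by rw [div_lt_iff₀ hδ] at h1; linarith
  exact (Matrix.PosDef.one.smul h3).add_posSemidef (h.smul h0.le)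

theorem rank_eq_of_gram_posDef {z : Matrix (Fin n) (Fin m) ℝ} (hz : (zᵀ * z).PosDef) :
    z.rank = m := by
  rw [← Matrix.rank_transpose_mul_self, Matrix.rank_of_isUnit _ hz.isUnit, Fintype.card_fin]

theorem gram_stdEmb_mul_msqrt (hmn : m ≤ n) {s : Matrix (Fin m) (Fin m) ℝ} (hs : s.PosSemidef) :
    (stdEmb n m * msqrt s)ᵀ * (stdEmb n m * msqrt s) = s := by
  rw [Matrix.transpose_mul, transpose_msqrt, Matrix.mul_assoc, ← Matrix.mul_assoc _ (stdEmb n m),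
    stdEmb_gram hmn, Matrix.one_mul, msqrt_mul_self hs]

theorem fourierMeasure_eq {ν : ComplexMeasure (Matrix (Fin n) (Fin m) ℝ)}
    {k : Matrix (Fin n) (Fin m) ℝ → ℂ} (hk : Measurable k)
    (hk1 : ∀ x, ‖k x‖ = 1) (hν : ∀ s, MeasurableSet s → ν s = ∫ x in s, k x ∂ν.variation)
    (y : Matrix (Fin n) (Fin m) ℝ) : fourierMeasure ν y =
      ∫ x, Complex.exp (Complex.I * ((yᵀ * x).trace : ℂ)) * k x ∂ν.variation :=
  integral_complexMeasure_eq hk hk1 hν _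

theorem continuous_fourierKernel :
    Continuous fun p : Matrix (Fin n) (Fin m) ℝ × Matrix (Fin n) (Fin m) ℝ =>
      Complex.exp (Complex.I * ((p.1ᵀ * p.2).trace : ℂ)) := by
  refine Complex.continuous_exp.comp (continuous_const.mul (Complex.continuous_ofReal.comp ?_))
  exact ((continuous_fst.matrix_transpose).matrix_mul continuous_snd).matrix_trace

theorem measurable_fourierMeasure (ν : ComplexMeasure (Matrix (Fin n) (Fin m) ℝ)) :
    Measurable (fourierMeasure ν) := by
  obtain ⟨k, hk, hk1, hν⟩ := exists_unimodular_density ν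
  have h : fourierMeasure ν = fun y =>
      ∫ x, Complex.exp (Complex.I * ((yᵀ * x).trace : ℂ)) * k x ∂ν.variation :=
    funext (fourierMeasure_eq hk hk1 hν)
  rw [h]
  exact (continuous_fourierKernel.measurable.mul
    (hk.comp measurable_snd)).stronglyMeasurable.integral_prod_right'.measurable

/-- A measurable version of the radial profile of `fourierMeasure ν`. -/
noncomputable def fourierProfile (ν : ComplexMeasure (Matrix (Fin n) (Fin m) ℝ))
    (s : Matrix (Fin m) (Fin m) ℝ) : ℂ := fourierMeasure ν (stdEmb n m * msqrt s)

theorem measurable_fourierProfile (ν : ComplexMeasure (Matrix (Fin n) (Fin m) ℝ)) :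
    Measurable (fourierProfile ν) := by
  refine (measurable_fourierMeasure ν).comp ?_
  have : Continuous fun q : Matrix (Fin m) (Fin m) ℝ => stdEmb n m * q := by fun_prop
  exact this.measurable.comp measurable_msqrt

variable {ν : ComplexMeasure (Matrix (Fin n) (Fin m) ℝ)} {u₀ : Matrix (Fin m) (Fin m) ℝ → ℂ}

/-- `u₀` is not assumed measurable; on the cone it coincides with this measurable function, because
`stdEmb n m * msqrt s` has Gram matrix `s`. -/
theorem fourierProfile_eq (hmn : m ≤ n)
    (hFν : ∀ y : Matrix (Fin n) (Fin m) ℝ, y.rank = m → fourierMeasure ν y = u₀ (yᵀ * y))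
    {s : Matrix (Fin m) (Fin m) ℝ} (hs : s.PosDef) : fourierProfile ν s = u₀ s := by
  have h := gram_stdEmb_mul_msqrt hmn hs.posSemidef
  rw [fourierProfile, hFν _ (rank_eq_of_gram_posDef (by rwa [h])), h]

/-- Polar decomposition: the integrand depends on `z` only through `zᵀz`, and the factor `2^m /
σ_{n,m}` cancels the constant of `gramMeasure_eq_smul_dStar`. -/
theorem truncatedConstant_eq (hm : 1 ≤ m) (hmn : m ≤ n)
    (hFν : ∀ y : Matrix (Fin n) (Fin m) ℝ, y.rank = m → fourierMeasure ν y = u₀ (yᵀ * y))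
    {A : Matrix (Fin m) (Fin m) ℝ} (hA : A.PosSemidef) (B : Matrix (Fin m) (Fin m) ℝ) :
    truncatedConstant ν A B = ∫ s in coneInterval A B, fourierProfile ν s ∂(dStar m) := by
  obtain ⟨hpos, hgram⟩ := gramMeasure_eq_smul_dStar (n := n) (m := m) (by lia) hmn
  have hS := measurableSet_coneInterval A B
  have hS' : MeasurableSet {z : Matrix (Fin n) (Fin m) ℝ | zᵀ * z ∈ coneInterval A B} :=
    measurable_gram hS
  have h1 : ∫ z in {z : Matrix (Fin n) (Fin m) ℝ | zᵀ * z ∈ coneInterval A B},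
      fourierMeasure ν z / ((matVol z ^ n : ℝ) : ℂ) =
      ∫ z in {z : Matrix (Fin n) (Fin m) ℝ | zᵀ * z ∈ coneInterval A B},
        fourierProfile ν (zᵀ * z) ∂(invVolume n m) := by
    rw [invVolume, setIntegral_withDensity_eq_setIntegral_toReal_smul
      measurable_invVolume_density (Eventually.of_forall fun _ => ENNReal.ofReal_lt_top) _ hS']
    refine setIntegral_congr_fun hS' fun z hz => ?_
    have hp : (zᵀ * z).PosDef := coneInterval_subset_cone hA hz
    rw [fourierProfile_eq hmn hFν hp, hFν z (rank_eq_of_gram_posDef hp),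
      ENNReal.toReal_ofReal (inv_nonneg.2 (pow_nonneg (matVol_nonneg z) n)), Complex.real_smul,
      Complex.ofReal_inv, div_eq_inv_mul]
  have h2 : ∫ z in {z : Matrix (Fin n) (Fin m) ℝ | zᵀ * z ∈ coneInterval A B},
      fourierProfile ν (zᵀ * z) ∂(invVolume n m) =
      ∫ s in coneInterval A B, fourierProfile ν s ∂(gramMeasure n m) :=
    (setIntegral_map hS (measurable_fourierProfile ν).aestronglyMeasurable
      measurable_gram.aemeasurable).symm
  rw [truncatedConstant, h1, h2, hgram, Measure.restrict_smul, integral_smul_measure,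
    ENNReal.toReal_ofReal hpos.le, Complex.real_smul, ← mul_assoc, ← Complex.ofReal_mul]
  have hσ : stiefelMass n m ≠ 0 := fun h => by simp [h] at hpos
  rw [show (2 ^ m / stiefelMass n m) * (stiefelMass n m / 2 ^ m) = 1 by field_simp]
  simp

/-- The heart of the proof. With `r = zᵀz`, the Gram matrix of `z a^{1/2}` is `a^{1/2} r a^{1/2}`.
Symmetry of `u₀` replaces it by `r^{1/2} a r^{1/2}`, a congruence of `a` that preserves `d_*a` and
carries the interval `(εI, ρI)` to `(εr, ρr)`. -/
theorem integral_fourierMeasure_mul_msqrt (hm : 1 ≤ m) (hmn : m ≤ n)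
    (hu₀ : IsSymmetricOnCone u₀)
    (hFν : ∀ y : Matrix (Fin n) (Fin m) ℝ, y.rank = m → fourierMeasure ν y = u₀ (yᵀ * y))
    {z : Matrix (Fin n) (Fin m) ℝ} (hz : (zᵀ * z).PosDef) {ε : ℝ} (hε : 0 < ε) (ρ : ℝ) :
    ∫ a in coneInterval (ε • (1 : Matrix (Fin m) (Fin m) ℝ)) (ρ • 1),
      fourierMeasure ν (z * msqrt a) ∂(dStar m) =
      truncatedConstant ν (ε • (zᵀ * z)) (ρ • (zᵀ * z)) := by
  set r := zᵀ * z with hr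
  set g := msqrt r with hg
  have hgu : IsUnit g.det := isUnit_det_msqrt hz
  have hgt : gᵀ = g := transpose_msqrt r
  have hgg : g * g = r := msqrt_mul_self hz.posSemidef
  have hI : ∀ t : ℝ, g * (t • (1 : Matrix (Fin m) (Fin m) ℝ)) * gᵀ = t • r := fun t => by
    rw [hgt, Matrix.mul_smul, Matrix.smul_mul, Matrix.mul_one, hgg]
  rw [truncatedConstant_eq hm hmn hFν (hz.posSemidef.smul hε.le)]
  conv_rhs => rw [← dStar_isCongrInvariant g hgu]
  rw [setIntegral_map (measurableSet_coneInterval _ _)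
    (measurable_fourierProfile ν).aestronglyMeasurable (measurable_congr g).aemeasurable]
  have hpre : (fun s => g * s * gᵀ) ⁻¹' coneInterval (ε • r) (ρ • r) =
      coneInterval (ε • (1 : Matrix (Fin m) (Fin m) ℝ)) (ρ • 1) := by
    ext s
    rw [Set.mem_preimage, ← hI, ← hI, coneInterval_congr hgu]
  rw [hpre]
  refine setIntegral_congr_fun (measurableSet_coneInterval _ _) fun a ha => ?_
  have ha' : a.PosDef := coneInterval_subset_cone (Matrix.PosSemidef.one.smul hε.le) ha
  have h1 : (z * msqrt a)ᵀ * (z * msqrt a) = msqrt a * r * msqrt a := by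
    rw [Matrix.transpose_mul, transpose_msqrt, hr]; simp only [Matrix.mul_assoc]
  have h2 : (msqrt a * r * msqrt a).PosDef := by
    have := (posDef_congr_iff (isUnit_det_msqrt ha') (s := r)).2 hz
    rwa [transpose_msqrt] at this
  have h3 : (g * a * gᵀ).PosDef := (posDef_congr_iff hgu).2 ha'
  rw [hFν _ (rank_eq_of_gram_posDef (by rwa [h1])), h1, fourierProfile_eq hmn hFν h3, hgt,
    hu₀ r a hz ha']

end Constant
end MatrixWavelet

/-! ### The multiplier of the truncated integral and passage to the limit. -/

namespace MatrixWavelet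

section Assembly

open scoped FourierTransform

variable {n m : ℕ} {Ω : Type*} [MeasurableSpace Ω]

theorem matEuclid_symm_measurePreserving : MeasurePreserving (matEuclid n m).symm :=
  (matEuclid_measurePreserving (n := n) (m := m)).symm (matEuclid n m).toMeasurableEquiv

theorem memLp_comp_matEuclid_symm {f : Matrix (Fin n) (Fin m) ℝ → ℂ} (hf : MemLp f 2 volume) :
    MemLp (f ∘ (matEuclid n m).symm) 2 volume :=
  hf.comp_measurePreserving matEuclid_symm_measurePreserving

theorem comp_matEuclid_symm_sub (f : Matrix (Fin n) (Fin m) ℝ → ℂ)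
    (x y : Matrix (Fin n) (Fin m) ℝ) :
    (f ∘ (matEuclid n m).symm) (matEuclid n m x - matEuclid n m y) = f (x - y) := by
  rw [← matEuclid_sub, Function.comp_apply, Homeomorph.symm_apply_apply]

theorem average_matrix_translates {f : Matrix (Fin n) (Fin m) ℝ → ℂ} (hf : MemLp f 2 volume)
    (Q : Measure Ω) [IsFiniteMeasure Q] {S : Ω → Matrix (Fin n) (Fin m) ℝ} (hS : Measurable S)
    {k : Ω → ℂ} (hk : Measurable k) (hk1 : ∀ ω, ‖k ω‖ ≤ 1) :
    (∀ᵐ x, Integrable (fun ω => f (x - S ω) * k ω) Q) ∧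
      MemLp (fun x => ∫ ω, f (x - S ω) * k ω ∂Q) 2 volume := by
  have hT : Measurable fun ω => matEuclid n m (S ω) := (matEuclid n m).measurable.comp hS
  obtain ⟨h1, h2⟩ := memLp_two_integral_prod
    (memLp_translates hT Q hk hk1 (memLp_comp_matEuclid_symm hf))
  constructor
  · filter_upwards [matEuclid_measurePreserving.quasiMeasurePreserving.ae h1] with x hx
    simpa only [comp_matEuclid_symm_sub] using hx
  · have h3 := h2.comp_measurePreserving (matEuclid_measurePreserving (n := n) (m := m))
    simpa only [Function.comp_def, ← matEuclid_sub, Homeomorph.symm_apply_apply] using h3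

theorem eLpNorm_average_matrix_sub {f : Matrix (Fin n) (Fin m) ℝ → ℂ} (hf : MemLp f 2 volume)
    (Q : Measure Ω) [IsFiniteMeasure Q] {S : Ω → Matrix (Fin n) (Fin m) ℝ} (hS : Measurable S)
    {k : Ω → ℂ} (hk : Measurable k) (hk1 : ∀ ω, ‖k ω‖ ≤ 1) (c : ℂ) :
    eLpNorm (fun x => (∫ ω, f (x - S ω) * k ω ∂Q) - c * f x) 2 volume =
      eLpNorm (fun ξ => (averageSymbol Q (fun ω => matEuclid n m (S ω)) k ξ - c) *
        (𝓕 ((memLp_comp_matEuclid_symm hf).toLp _) :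
          Lp (α := EuclideanSpace ℝ (Fin n × Fin m)) ℂ 2 volume) ξ) 2 volume := by
  have hT : Measurable fun ω => matEuclid n m (S ω) := (matEuclid n m).measurable.comp hS
  have hf' := memLp_comp_matEuclid_symm hf
  have hg := (memLp_two_integral_prod (memLp_translates hT Q hk hk1 hf')).2
  have h := eLpNorm_comp_measurePreserving (p := 2)
    (hg.aestronglyMeasurable.sub (hf'.aestronglyMeasurable.const_mul c))
    (matEuclid_measurePreserving (n := n) (m := m))
  refine Eq.trans ?_ (h.trans (eLpNorm_average_sub hf' hT Q hk hk1 c))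
  simp only [Function.comp_def, Pi.sub_apply, ← matEuclid_sub, Homeomorph.symm_apply_apply]

theorem waveletTransform_eq {ν : ComplexMeasure (Matrix (Fin n) (Fin m) ℝ)}
    {k : Matrix (Fin n) (Fin m) ℝ → ℂ} (hk : Measurable k)
    (hk1 : ∀ x, ‖k x‖ = 1) (hν : ∀ s, MeasurableSet s → ν s = ∫ x in s, k x ∂ν.variation)
    (a : Matrix (Fin m) (Fin m) ℝ) (f : Matrix (Fin n) (Fin m) ℝ → ℂ)
    (x : Matrix (Fin n) (Fin m) ℝ) : waveletTransform ν a f x =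
      ∫ y, f (x - y * msqrt a) * k y ∂ν.variation :=
  integral_complexMeasure_eq hk hk1 hν _

theorem measurable_mul_msqrt :
    Measurable fun q : Matrix (Fin m) (Fin m) ℝ × Matrix (Fin n) (Fin m) ℝ => q.2 * msqrt q.1 := by
  have h : Continuous fun q : Matrix (Fin m) (Fin m) ℝ × Matrix (Fin n) (Fin m) ℝ => q.2 * q.1 :=
    continuous_snd.matrix_mul continuous_fst
  exact h.measurable.comp ((measurable_msqrt.comp measurable_fst).prodMk measurable_snd)

theorem averageSymbol_eq_truncatedConstant {ν : ComplexMeasure (Matrix (Fin n) (Fin m) ℝ)}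
    {u₀ : Matrix (Fin m) (Fin m) ℝ → ℂ} (hm : 1 ≤ m) (hmn : m ≤ n)
    (hu₀ : IsSymmetricOnCone u₀)
    (hFν : ∀ y : Matrix (Fin n) (Fin m) ℝ, y.rank = m → fourierMeasure ν y = u₀ (yᵀ * y))
    {k : Matrix (Fin n) (Fin m) ℝ → ℂ} (hk : Measurable k)
    (hk1 : ∀ x, ‖k x‖ = 1) (hν : ∀ s, MeasurableSet s → ν s = ∫ x in s, k x ∂ν.variation)
    {ε : ℝ} (hε : 0 < ε) (ρ : ℝ) {ζ : Matrix (Fin n) (Fin m) ℝ} (hζ : matVol ζ ≠ 0) :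
    averageSymbol (((dStar m).restrict (coneInterval (ε • 1) (ρ • 1))).prod ν.variation)
      (fun q => matEuclid n m (q.2 * msqrt q.1)) (fun q => k q.2) (matEuclid n m ζ) =
      truncatedConstant ν (ε • ((2 * Real.pi) ^ 2 • (ζᵀ * ζ)))
        (ρ • ((2 * Real.pi) ^ 2 • (ζᵀ * ζ))) := by
  -- The transform on `V` uses the kernel `exp(-2πi⟨·,·⟩)`, that of `ν` uses `exp(i tr)`; the sign
  -- disappears in `zᵀz`.
  set z := (-(2 * Real.pi)) • ζ with hz
  have hzz : zᵀ * z = (2 * Real.pi) ^ 2 • (ζᵀ * ζ) := by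
    rw [hz, Matrix.transpose_smul, Matrix.smul_mul, Matrix.mul_smul, smul_smul]
    congr 1; ring
  have hzp : (zᵀ * z).PosDef := by
    rw [hzz]
    exact (gram_posDef_iff.2 hζ).smul (by positivity)
  have hfin : IsFiniteMeasure
      ((dStar m).restrict (coneInterval (ε • (1 : Matrix (Fin m) (Fin m) ℝ)) (ρ • 1))) :=
    isFiniteMeasure_restrict.2 (dStar_coneInterval_lt_top hε ρ).ne
  rw [← hzz, ← integral_fourierMeasure_mul_msqrt hm hmn hu₀ hFν hzp hε]
  have hT : Measurable fun q : Matrix (Fin m) (Fin m) ℝ × Matrix (Fin n) (Fin m) ℝ =>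
      matEuclid n m (q.2 * msqrt q.1) := (matEuclid n m).measurable.comp measurable_mul_msqrt
  have hmeas := (measurable_averageKernel hT (hk.comp measurable_snd)).comp
    (measurable_prodMk_left (x := matEuclid n m ζ))
  rw [averageSymbol, integral_prod]
  · congr 1
    ext a
    rw [fourierMeasure_eq hk hk1 hν]
    congr 1
    ext y
    congr 1
    simp only [inner_matEuclid]
    rw [Real.fourierChar_apply]
    congr 1
    have h1 : ((z * msqrt a)ᵀ * y).trace = -(2 * Real.pi) * (ζᵀ * (y * msqrt a)).trace := by
      rw [Matrix.transpose_mul, transpose_msqrt, Matrix.mul_assoc, Matrix.trace_mul_comm, hz,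
        Matrix.transpose_smul, Matrix.smul_mul, Matrix.smul_mul, Matrix.trace_smul, smul_eq_mul,
        Matrix.mul_assoc]
    rw [h1]
    push_cast
    ring
  · refine Integrable.of_bound hmeas.aestronglyMeasurable 1 (Eventually.of_forall fun q => ?_)
    rw [norm_mul, Circle.norm_coe, one_mul, hk1]

theorem ae_matVol_matEuclid_symm_ne_zero (hmn : m ≤ n) :
    ∀ᵐ ξ, matVol ((matEuclid n m).symm ξ) ≠ 0 :=
  matEuclid_symm_measurePreserving.quasiMeasurePreserving.ae (ae_matVol_ne_zero hmn)

variable {ν : ComplexMeasure (Matrix (Fin n) (Fin m) ℝ)} {k : Matrix (Fin n) (Fin m) ℝ → ℂ}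
  {f : Matrix (Fin n) (Fin m) ℝ → ℂ}

theorem isFiniteMeasure_dStar_restrict {ε : ℝ} (hε : 0 < ε) (ρ : ℝ) : IsFiniteMeasure
    ((dStar m).restrict (coneInterval (ε • (1 : Matrix (Fin m) (Fin m) ℝ)) (ρ • 1))) :=
  isFiniteMeasure_restrict.2 (dStar_coneInterval_lt_top hε ρ).ne

/-- Joint integrability in `(a, y)` for almost every `x` comes from the `L²` bound for averages over
a finite measure; Fubini gives the rest. -/
theorem truncatedCalderon_ae_eq (hk : Measurable k)
    (hk1 : ∀ x, ‖k x‖ = 1) (hν : ∀ s, MeasurableSet s → ν s = ∫ x in s, k x ∂ν.variation)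
    (hf : MemLp f 2 volume) {ε : ℝ} (hε : 0 < ε) (ρ : ℝ) :
    (∀ᵐ x, IntegrableOn (fun a => waveletTransform ν a f x)
      (coneInterval (ε • (1 : Matrix (Fin m) (Fin m) ℝ)) (ρ • 1)) (dStar m)) ∧
    truncatedCalderon ν ε ρ f =ᵐ[volume] fun x => ∫ q, f (x - q.2 * msqrt q.1) * k q.2
      ∂(((dStar m).restrict (coneInterval (ε • 1) (ρ • 1))).prod ν.variation) := by
  have := isFiniteMeasure_dStar_restrict (m := m) hε ρ
  have h := (average_matrix_translates hf
    (((dStar m).restrict (coneInterval (ε • 1) (ρ • 1))).prod ν.variation) measurable_mul_msqrt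
    (hk.comp measurable_snd) fun q => (hk1 q.2).le).1
  constructor
  · filter_upwards [h] with x hx
    simp only [IntegrableOn, waveletTransform_eq hk hk1 hν]
    exact hx.integral_prod_left
  · filter_upwards [h] with x hx
    rw [truncatedCalderon]
    simp only [waveletTransform_eq hk hk1 hν]
    exact (integral_prod _ hx).symm

theorem tendsto_smul_prod {r : Matrix (Fin m) (Fin m) ℝ} (hr : r.PosDef) :
    Tendsto (fun p : ℝ × ℝ => (p.1 • r, p.2 • r)) (𝓝[>] 0 ×ˢ atTop)
      (coneNhdsZero m ×ˢ coneAtTop m) :=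
  Tendsto.prodMk ((tendsto_smul_coneNhdsZero hr).comp tendsto_fst)
    ((tendsto_smul_coneAtTop hr).comp tendsto_snd)

/-- Dominated convergence with majorant `(C + |c|)² |F|²`. -/
theorem tendsto_eLpNorm_multiplier_sub {X ι : Type*} [MeasurableSpace X] {μ : Measure X}
    {l : Filter ι} [l.IsCountablyGenerated] {M : ι → X → ℂ} {F : X → ℂ} {c : ℂ} {C : ℝ}
    (hF : MemLp F 2 μ) (hM : ∀ᶠ p in l, AEMeasurable (M p) μ)
    (hC : ∀ᶠ p in l, ∀ᵐ ξ ∂μ, ‖M p ξ‖ ≤ C)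
    (hlim : ∀ᵐ ξ ∂μ, Tendsto (fun p => M p ξ) l (𝓝 c)) :
    Tendsto (fun p => eLpNorm (fun ξ => (M p ξ - c) * F ξ) 2 μ) l (𝓝 0) := by
  have h : Tendsto (fun p => ∫⁻ ξ, ‖(M p ξ - c) * F ξ‖ₑ ^ (2 : ℝ) ∂μ) l (𝓝 (∫⁻ _, 0 ∂μ)) := by
    refine tendsto_lintegral_filter_of_dominated_convergence'
      (fun ξ => ENNReal.ofReal (C + ‖c‖) ^ (2 : ℝ) * ‖F ξ‖ₑ ^ (2 : ℝ)) ?_ ?_ ?_ ?_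
    · exact hM.mono fun p hp => (((hp.sub_const c).mul
        hF.aestronglyMeasurable.aemeasurable).enorm).pow_const _
    · refine hC.mono fun p hp => hp.mono fun ξ hξ => ?_
      rw [enorm_mul, ENNReal.mul_rpow_of_nonneg _ _ zero_le_two]
      gcongr
      rw [← ofReal_norm]
      exact ENNReal.ofReal_le_ofReal ((norm_sub_le _ _).trans (by gcongr))
    · rw [lintegral_const_mul' _ _ (by finiteness)]
      refine ENNReal.mul_ne_top (by finiteness) ?_
      have := (eLpNorm_lt_top_iff_lintegral_rpow_enorm_lt_top two_ne_zero
        ENNReal.ofNat_ne_top).1 hF.2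
      simpa using this.ne
    · filter_upwards [hlim] with ξ hξ
      have h2 := (((hξ.sub_const c).mul_const (F ξ)).enorm).ennrpow_const (2 : ℝ)
      simpa using h2
  have h3 := h.ennrpow_const (1 / (2 : ℝ))
  rw [lintegral_zero, ENNReal.zero_rpow_of_pos (by norm_num)] at h3
  simpa only [eLpNorm_eq_lintegral_rpow_enorm_toReal two_ne_zero ENNReal.ofNat_ne_top,
    ENNReal.toReal_ofNat] using h3

theorem tendsto_eLpNorm_truncatedCalderon_sub {u₀ : Matrix (Fin m) (Fin m) ℝ → ℂ} (hm : 1 ≤ m)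
    (hmn : m ≤ n) (hu₀ : IsSymmetricOnCone u₀)
    (hFν : ∀ y : Matrix (Fin n) (Fin m) ℝ, y.rank = m → fourierMeasure ν y = u₀ (yᵀ * y))
    {c : ℂ} (hc : Tendsto (fun p : Matrix (Fin m) (Fin m) ℝ × Matrix (Fin m) (Fin m) ℝ =>
      truncatedConstant ν p.1 p.2) (coneNhdsZero m ×ˢ coneAtTop m) (𝓝 c))
    {C : ℝ} (hC : ∀ A B : Matrix (Fin m) (Fin m) ℝ, A.PosDef → B.PosDef →
      ‖truncatedConstant ν A B‖ ≤ C)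
    (hf : MemLp f 2 volume) :
    Tendsto (fun p : ℝ × ℝ =>
      eLpNorm (fun x => truncatedCalderon ν p.1 p.2 f x - c * f x) 2 volume)
      (𝓝[>] 0 ×ˢ atTop) (𝓝 0) := by
  obtain ⟨k, hk, hk1, hν⟩ := exists_unimodular_density ν
  set F : EuclideanSpace ℝ (Fin n × Fin m) → ℂ :=
    ⇑(𝓕 ((memLp_comp_matEuclid_symm hf).toLp _) :
      Lp (α := EuclideanSpace ℝ (Fin n × Fin m)) ℂ 2 volume) with hF
  have hF2 : MemLp F 2 volume := Lp.memLp _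
  set r : EuclideanSpace ℝ (Fin n × Fin m) → Matrix (Fin m) (Fin m) ℝ := fun ξ =>
    (2 * Real.pi) ^ 2 • (((matEuclid n m).symm ξ)ᵀ * (matEuclid n m).symm ξ) with hr
  have hr' : ∀ᵐ ξ, (r ξ).PosDef := (ae_matVol_matEuclid_symm_ne_zero hmn).mono fun ξ hξ =>
    (gram_posDef_iff.2 hξ).smul (by positivity)
  set M : ℝ × ℝ → EuclideanSpace ℝ (Fin n × Fin m) → ℂ := fun p => averageSymbol
    (((dStar m).restrict (coneInterval (p.1 • 1) (p.2 • 1))).prod ν.variation)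
    (fun q => matEuclid n m (q.2 * msqrt q.1)) (fun q => k q.2) with hM
  have hpos : ∀ᶠ p : ℝ × ℝ in 𝓝[>] 0 ×ˢ atTop, 0 < p.1 ∧ 0 < p.2 :=
    (eventually_mem_nhdsWithin (s := Set.Ioi (0 : ℝ))).prod_mk (eventually_gt_atTop 0)
  have hMeq' : ∀ p : ℝ × ℝ, 0 < p.1 → ∀ ξ, matVol ((matEuclid n m).symm ξ) ≠ 0 →
      M p ξ = truncatedConstant ν (p.1 • r ξ) (p.2 • r ξ) := fun p hp ξ hξ => by
    have h := averageSymbol_eq_truncatedConstant hm hmn hu₀ hFν hk hk1 hν hp p.2 hξ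
    rwa [Homeomorph.apply_symm_apply] at h
  have hMeq : ∀ p : ℝ × ℝ, ∀ᵐ ξ, 0 < p.1 →
      M p ξ = truncatedConstant ν (p.1 • r ξ) (p.2 • r ξ) := fun p =>
    (ae_matVol_matEuclid_symm_ne_zero hmn).mono fun ξ hξ hp => hMeq' p hp ξ hξ
  have hk2 : Measurable fun q : Matrix (Fin m) (Fin m) ℝ × Matrix (Fin n) (Fin m) ℝ => k q.2 :=
    hk.comp measurable_snd
  have hnorm : ∀ p : ℝ × ℝ, 0 < p.1 →
      eLpNorm (fun x => truncatedCalderon ν p.1 p.2 f x - c * f x) 2 volume =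
        eLpNorm (fun ξ => (M p ξ - c) * F ξ) 2 volume := fun p hp => by
    have := isFiniteMeasure_dStar_restrict (m := m) hp p.2
    rw [← eLpNorm_average_matrix_sub hf _ measurable_mul_msqrt hk2 (fun q => (hk1 q.2).le)]
    exact eLpNorm_congr_ae ((truncatedCalderon_ae_eq hk hk1 hν hf hp p.2).2.sub EventuallyEq.rfl)
  refine (tendsto_eLpNorm_multiplier_sub (M := M) (c := c) (C := C) hF2 ?_ ?_ ?_).congr'
    (hpos.mono fun p hp => (hnorm p hp.1).symm)
  · filter_upwards [hpos] with p hp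
    have := isFiniteMeasure_dStar_restrict (m := m) hp.1 p.2
    exact (measurable_averageSymbol _
      ((matEuclid n m).measurable.comp measurable_mul_msqrt) hk2).aemeasurable
  · filter_upwards [hpos] with p hp
    filter_upwards [hr', hMeq p] with ξ hξ hξ'
    rw [hξ' hp.1]
    exact hC _ _ (hξ.smul hp.1) (hξ.smul hp.2)
  · filter_upwards [hr', ae_matVol_matEuclid_symm_ne_zero hmn] with ξ hξ hξ'
    -- For fixed `ξ` the pair `(εr, ρr)` moves along a ray of the cone, to `0` and to infinity.
    exact (hc.comp (tendsto_smul_prod hξ)).congr' (hpos.mono fun p hp => (hMeq' p hp.1 ξ hξ').symm)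

end Assembly
end MatrixWavelet

theorem mainTheorem1 (n m : ℕ) (hm : 1 ≤ m) (hmn : m ≤ n)
    (ν : ComplexMeasure (Matrix (Fin n) (Fin m) ℝ)) (hν : IsRadial ν)
    (u₀ : Matrix (Fin m) (Fin m) ℝ → ℂ) (hu₀ : IsSymmetricOnCone u₀)
    (hFν : ∀ y : Matrix (Fin n) (Fin m) ℝ, y.rank = m → fourierMeasure ν y = u₀ (yᵀ * y))
    (c : ℂ)
    (hc : Tendsto (fun p : Matrix (Fin m) (Fin m) ℝ × Matrix (Fin m) (Fin m) ℝ =>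
      truncatedConstant ν p.1 p.2) (coneNhdsZero m ×ˢ coneAtTop m) (𝓝 c))
    (hbdd : ∃ C : ℝ, ∀ A B : Matrix (Fin m) (Fin m) ℝ, A.PosDef → B.PosDef →
      ‖truncatedConstant ν A B‖ ≤ C)
    (f : Matrix (Fin n) (Fin m) ℝ → ℂ) (hf : MemLp f 2 volume) :
    (∀ a : Matrix (Fin m) (Fin m) ℝ, a.PosDef →
      ∀ᵐ x : Matrix (Fin n) (Fin m) ℝ, ν.Integrable (fun y => f (x - y * msqrt a))) ∧
    (∀ ε ρ : ℝ, 0 < ε → ε < ρ →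
      (∀ᵐ x : Matrix (Fin n) (Fin m) ℝ,
        IntegrableOn (fun a => waveletTransform ν a f x)
          (coneInterval (ε • (1 : Matrix (Fin m) (Fin m) ℝ)) (ρ • 1)) (dStar m)) ∧
      MemLp (truncatedCalderon ν ε ρ f) 2 volume) ∧
    Tendsto (fun p : ℝ × ℝ =>
      eLpNorm (fun x => truncatedCalderon ν p.1 p.2 f x - c * f x) 2 volume)
      (𝓝[>] 0 ×ˢ atTop) (𝓝 0) := by
  obtain ⟨k, hk, hk1, hνk⟩ := exists_unimodular_density ν
  obtain ⟨C, hC⟩ := hbdd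
  refine ⟨fun a _ => ?_, fun ε ρ hε _ => ?_,
    tendsto_eLpNorm_truncatedCalderon_sub hm hmn hu₀ hFν hc hC hf⟩
  · have hS : Measurable fun y : Matrix (Fin n) (Fin m) ℝ => y * msqrt a :=
      measurable_mul_right (msqrt a)
    -- Integrability against `ν` means integrability against its variation, so the density is taken
    -- to be `1`.
    have h := (average_matrix_translates hf ν.variation hS
      (measurable_const (a := (1 : ℂ))) fun _ => norm_one.le).1
    simpa only [mul_one] using h
  · obtain ⟨h1, h2⟩ := truncatedCalderon_ae_eq hk hk1 hνk hf hε ρ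
    have := isFiniteMeasure_dStar_restrict (m := m) hε ρ
    exact ⟨h1, (memLp_congr_ae h2).2 (average_matrix_translates hf _ measurable_mul_msqrt
      (hk.comp measurable_snd) fun q => (hk1 q.2).le).2⟩
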